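/- Let $\pi : P \to M$ be a smooth principal ${\rm SU}(2)$ bundle with (right) ${\rm SU}(2)$ action over a smooth 3-dimensional manifold $M$, so that $P$ is a smooth 6-dimensional manifold. Let $W$ be a connection in $P$, viewed as an $\mathfrak{su}(2)$-valued 1-form on $P$, that is, $R_g^* W = g^{-1} W g$ and $W$ restricts to the Maurer–Cartan form on the fibres. Let $E$ be a smooth $\mathfrak{su}(2)$-valued 1-form on $P$ with $R_g^*E = g^{-1} E g$ that vanishes on vertical vectors and is injective on the horizontal spaces $\ker W_p$ (so that $-2\,{\rm Tr}(E\otimes E)$ is the lift to $P$ of a Riemannian metric on $M$, and $E$ is a frame for this metric). Write $W=\sum_i W^i\tau_i$, $E=\sum_i E^i\tau_i$ with $\tau_i=-\tfrac{i}{2}\sigma_i$ ($\sigma_i$ the Pauli matrices), let $\partial/\partial W^i,\ \partial/\partial E^i$ be the basis of vector fields on $P$ dual to the coframe $W^i, E^i$, and let $$J_{E,W}=\sum_i\Big(E^i\otimes\frac{\partial}{\partial W^i}-W^i\otimes\frac{\partial}{\partial E^i}\Big)$$ be the resulting almost-complex structure on $P$. It is called integrable if it is induced by a complex structure, i.e.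 if around every point of $P$ there are smooth local coordinates $z$ with values in $\mathbb C^3$ and $dz\circ J_{E,W}=i\,dz$. Let $A=W+iE$, and for matrix-valued 1-forms let $(\alpha\wedge\beta)(u,v)=\alpha(u)\beta(v)-\alpha(v)\beta(u)$, where the products on the right are matrix products. Then: 1. $J_{E,W}$ is integrable if and only if the ${\rm SL}(2,\mathbb C)$ connection $A$ is flat: $F(A)\equiv dA+A\wedge A=0$ on $P$. 2. $J_{E,W}$ is integrable if and only if both $\nabla E\equiv dE+W\wedge E+E\wedge W=0$ (the connection $W$ is torsion-free) and $F(W)\equiv dW+W\wedge W=E\wedge E$ (the metric has constant negative curvature). -/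

import Mathlib

open scoped Manifold ContDiff Matrix

noncomputable section

namespace SU2Lift

/-! ### The group `SU(2)` and its Lie algebra -/

/-- Complex `2 × 2` matrices. -/
abbrev Mat2 : Type := Matrix (Fin 2) (Fin 2) ℂ

/-- The group `SU(2)`. -/
abbrev SU2 : Type := Matrix.specialUnitaryGroup (Fin 2) ℂ

/-- `ℝ⁴`, in which `SU(2)` is realised as the unit sphere. -/
abbrev R4 : Type := EuclideanSpace ℝ (Fin (3 + 1))

/-- The point `(Re z, Im z, Re w, Im w)` of `ℝ⁴`, where `(z, w)` is the first column. -/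
def toR4 (g : Mat2) : R4 := !₂[(g 0 0).re, (g 0 0).im, (g 1 0).re, (g 1 0).im]

/-- The matrix with rows `(z, -w̄)` and `(w, z̄)`, where `z = x₀ + i x₁` and `w = x₂ + i x₃`. -/
def ofR4 (x : R4) : Mat2 := !![⟨x 0, x 1⟩, -⟨x 2, -x 3⟩; ⟨x 2, x 3⟩, ⟨x 0, -x 1⟩]

theorem toR4_mem (g : SU2) : toR4 g.1 ∈ Metric.sphere (0 : R4) 1 := by
  have h := congrFun (congrFun (Matrix.mem_unitaryGroup_iff'.1 g.2.1) 0) 0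
  have h' := congrArg Complex.re h
  simp [Matrix.mul_apply, Fin.sum_univ_two, Matrix.star_apply] at h'
  rw [mem_sphere_zero_iff_norm, EuclideanSpace.norm_eq, Real.sqrt_eq_one]
  simp [toR4, Fin.sum_univ_four]
  linarith

theorem ofR4_mem (x : Metric.sphere (0 : R4) 1) :
    ofR4 x.1 ∈ Matrix.specialUnitaryGroup (Fin 2) ℂ := by
  have hx := x.2
  rw [mem_sphere_zero_iff_norm, EuclideanSpace.norm_eq, Real.sqrt_eq_one] at hx
  simp [Fin.sum_univ_four] at hx
  rw [Matrix.mem_specialUnitaryGroup_iff, Matrix.mem_unitaryGroup_iff']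
  constructor
  · ext i j
    fin_cases i <;> fin_cases j <;>
      simp [ofR4, Matrix.mul_apply, Fin.sum_univ_two, Matrix.star_apply, Complex.ext_iff] <;>
      constructor <;> linarith
  · simp [ofR4, Matrix.det_fin_two, Complex.ext_iff]
    constructor <;> linarith

theorem ofR4_toR4 (g : SU2) : ofR4 (toR4 g.1) = g.1 := by
  obtain ⟨g, hu, hd⟩ := g
  have hinv : star g = g.adjugate := by
    have h1 : star g * g = 1 := Matrix.mem_unitaryGroup_iff'.1 hu
    have h2 : g * g.adjugate = 1 := by
      rw [Matrix.mul_adjugate]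
      have : g.det = 1 := hd
      rw [this, one_smul]
    calc star g = star g * (g * g.adjugate) := by rw [h2, mul_one]
      _ = g.adjugate := by rw [← mul_assoc, h1, one_mul]
  have h0 := congrFun (congrFun hinv 0) 0
  have h1 := congrFun (congrFun hinv 0) 1
  simp [Matrix.adjugate_fin_two, Matrix.star_apply, Complex.ext_iff] at h0 h1
  ext i j
  fin_cases i <;> fin_cases j <;>
    simp [ofR4, toR4, Complex.ext_iff] <;> constructor <;> linarith

theorem toR4_ofR4 (x : R4) : toR4 (ofR4 x) = x := by
  ext i
  fin_cases i <;> simp [ofR4, toR4]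

/-- The standard homeomorphism between `SU(2)` and the unit sphere of `ℝ⁴`. -/
def sphereHomeo : SU2 ≃ₜ Metric.sphere (0 : R4) 1 where
  toFun g := ⟨toR4 g.1, toR4_mem g⟩
  invFun x := ⟨ofR4 x.1, ofR4_mem x⟩
  left_inv g := Subtype.ext (ofR4_toR4 g)
  right_inv x := Subtype.ext (toR4_ofR4 x.1)
  continuous_toFun := by
    refine Continuous.subtype_mk ?_ _
    unfold toR4
    refine (PiLp.continuous_toLp 2 _).comp (continuous_pi fun i => ?_)
    have h (a b : Fin 2) : Continuous fun g : SU2 => g.1 a b :=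
      (continuous_apply_apply a b).comp continuous_subtype_val
    fin_cases i
    · exact Complex.continuous_re.comp (h 0 0)
    · exact Complex.continuous_im.comp (h 0 0)
    · exact Complex.continuous_re.comp (h 1 0)
    · exact Complex.continuous_im.comp (h 1 0)
  continuous_invFun := by
    refine Continuous.subtype_mk ?_ _
    have hx (i : Fin 4) : Continuous fun x : Metric.sphere (0 : R4) 1 => x.1 i :=
      (continuous_apply i).comp ((PiLp.continuous_ofLp 2 _).comp continuous_subtype_val)
    have hc {f k : Metric.sphere (0 : R4) 1 → ℝ} (hf : Continuous f) (hk : Continuous k) :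
        Continuous fun x => (⟨f x, k x⟩ : ℂ) := by
      have : (fun x => (⟨f x, k x⟩ : ℂ)) = fun x => (f x : ℂ) + (k x : ℂ) * Complex.I := by
        funext x
        apply Complex.ext <;> simp
      rw [this]
      fun_prop
    refine continuous_pi fun i => continuous_pi fun j => ?_
    fin_cases i <;> fin_cases j
    · exact hc (hx 0) (hx 1)
    · exact (hc (hx 2) (hx 3).neg).neg
    · exact hc (hx 2) (hx 3)
    · exact hc (hx 0) (hx 1).neg

/-- The smooth structure of `SU(2) ≅ S³`. -/
instance : ChartedSpace (EuclideanSpace ℝ (Fin 3)) SU2 where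
  atlas := {e | ∃ c ∈ atlas (EuclideanSpace ℝ (Fin 3)) (Metric.sphere (0 : R4) 1),
    e = sphereHomeo.toOpenPartialHomeomorph.trans c}
  chartAt g := sphereHomeo.toOpenPartialHomeomorph.trans
    (chartAt (EuclideanSpace ℝ (Fin 3)) (sphereHomeo g))
  mem_chart_source g := by simp
  chart_mem_atlas g := ⟨_, chart_mem_atlas _ _, rfl⟩

instance : IsManifold (𝓡 3) ∞ SU2 where
  compatible := by
    rintro e e' ⟨c, hc, rfl⟩ ⟨c', hc', rfl⟩
    have hS : IsManifold (𝓡 3) ∞ (Metric.sphere (0 : R4) 1) := IsManifold.of_le (n := ω) le_top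
    have h := hS.compatible hc hc'
    have hid : (sphereHomeo.toOpenPartialHomeomorph.trans c).symm.trans
        (sphereHomeo.toOpenPartialHomeomorph.trans c') = c.symm.trans c' := by
      rw [OpenPartialHomeomorph.trans_symm_eq_symm_trans_symm, OpenPartialHomeomorph.trans_assoc,
        ← OpenPartialHomeomorph.trans_assoc sphereHomeo.toOpenPartialHomeomorph.symm,
        ← Homeomorph.symm_toOpenPartialHomeomorph, ← Homeomorph.trans_toOpenPartialHomeomorph,
        Homeomorph.symm_trans_self, Homeomorph.refl_toOpenPartialHomeomorph,
        OpenPartialHomeomorph.refl_trans]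
    rw [hid]
    exact h

/-- The generators `τᵢ = -(i/2) σᵢ` of `su(2)`, with `σᵢ` the Pauli matrices. -/
def tau : Fin 3 → Mat2 :=
  ![(-(Complex.I / 2)) • !![0, 1; 1, 0],
    (-(Complex.I / 2)) • !![0, -Complex.I; Complex.I, 0],
    (-(Complex.I / 2)) • !![1, 0; 0, -1]]

/-- The Lie algebra `su(2)`: trace-free anti-hermitian matrices. -/
def su2 : Set Mat2 := {X | Xᴴ = -X ∧ X.trace = 0}

/-- The component `Xⁱ = -2 Tr (X τᵢ)` of `X = ∑ᵢ Xⁱ τᵢ` in `su(2)`. -/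
def comp (i : Fin 3) : Mat2 →ₗ[ℝ] ℝ where
  toFun X := -2 * ((X * tau i).trace).re
  map_add' X Y := by simp [add_mul]; ring
  map_smul' r X := by simp; ring

/-- On `su(2)` the components are the coordinates with respect to `τ`. -/
theorem sum_comp_tau {X : Mat2} (hX : X ∈ su2) : ∑ i, comp i X • tau i = X := by
  obtain ⟨h, ht⟩ := hX
  have h00 := congrFun (congrFun h 0) 0
  have h01 := congrFun (congrFun h 0) 1
  simp [Complex.ext_iff] at h00 h01
  simp [Matrix.trace_fin_two, Complex.ext_iff] at ht
  ext i j
  fin_cases i <;> fin_cases j <;>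
    simp [comp, tau, Fin.sum_univ_three, Matrix.trace_fin_two, Matrix.mul_apply,
      Fin.sum_univ_two, Complex.ext_iff] <;> constructor <;> linarith

/-- The tangent vector `X` of `SU(2)` at `1`, viewed as a matrix: the differential at `1` of the
inclusion `SU(2) → Mat2`, computed entrywise. -/
def tangentMatrix (X : TangentSpace (𝓡 3) (1 : SU2)) : Mat2 := Matrix.of fun a b =>
  (show ℂ from mfderiv (𝓡 3) 𝓘(ℝ, ℂ) (fun g : SU2 => g.1 a b) 1 X)

/-! ### Matrix-valued forms on a 6-manifold -/

/-- `ℝ⁶`, the model space of the total space. -/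
abbrev R6 : Type := EuclideanSpace ℝ (Fin 6)

section Forms

variable {P : Type*} [TopologicalSpace P] [ChartedSpace R6 P]

/-- A field of real-linear maps `T_pP → Mat2`, that is, a matrix-valued 1-form on `P`. -/
abbrev Form1 (P : Type*) [TopologicalSpace P] [ChartedSpace R6 P] : Type _ :=
  ∀ p : P, TangentSpace (𝓡 6) p →ₗ[ℝ] Mat2

/-- A matrix-valued 2-form on `P`, as a function of two tangent vectors. -/
abbrev Form2 (P : Type*) [TopologicalSpace P] [ChartedSpace R6 P] : Type _ :=
  ∀ p : P, TangentSpace (𝓡 6) p → TangentSpace (𝓡 6) p → Mat2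

/-- A 1-form is smooth if its matrix entries are smooth as functions on the tangent bundle. -/
def IsSmooth [IsManifold (𝓡 6) ∞ P] (α : Form1 P) : Prop :=
  ∀ a b : Fin 2, ContMDiff (𝓡 6).tangent 𝓘(ℝ, ℂ) ∞
    (fun v : TangentBundle (𝓡 6) P => α v.1 v.2 a b)

/-- The coordinates of a tangent vector at `p` in the preferred chart at `p`. -/
def chartVector (p : P) (u : TangentSpace (𝓡 6) p) : R6 :=
  mfderiv (𝓡 6) 𝓘(ℝ, R6) (extChartAt (𝓡 6) p) p u

/-- The vector field on the domain of the preferred chart at `p` whose coordinates are constantly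
`w`, at the point with coordinates `y`. -/
def constField (p : P) (w y : R6) : TangentSpace (𝓡 6) ((extChartAt (𝓡 6) p).symm y) :=
  mfderiv 𝓘(ℝ, R6) (𝓡 6) (extChartAt (𝓡 6) p).symm y w

/-- The entry `(a, b)` of `D_u (α(w))` at `p`, where `α(w)` is the value of `α` on the vector field
that is constantly `w` in the preferred chart at `p`. -/
def coordDeriv (α : Form1 P) (p : P) (u w : R6) (a b : Fin 2) : ℂ :=
  fderiv ℝ (fun y : R6 => α ((extChartAt (𝓡 6) p).symm y) (constField p w y) a b)
    (extChartAt (𝓡 6) p p) u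

/-- The exterior derivative of a 1-form, computed in the preferred chart at `p`:
`dα (u, v) = D_u (α v) - D_v (α u)`, with `u` and `v` extended constantly. -/
def extD (α : Form1 P) : Form2 P := fun p u v => Matrix.of fun a b =>
  coordDeriv α p (chartVector p u) (chartVector p v) a b -
    coordDeriv α p (chartVector p v) (chartVector p u) a b

/-- The wedge product of matrix-valued 1-forms:
`(α ∧ β) (u, v) = α u * β v - α v * β u`. -/
def wedge (α β : Form1 P) : Form2 P := fun p u v => α p u * β p v - α p v * β p u

/-- The curvature `F(α) = dα + α ∧ α`. -/
def curvature (α : Form1 P) : Form2 P := extD α + wedge α α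

/-- The covariant exterior derivative `∇_γ α = dα + γ ∧ α + α ∧ γ`. -/
def covD (γ α : Form1 P) : Form2 P := extD α + wedge γ α + wedge α γ

/-- The differential `dz_q : T_qP → ℂ³` of a `ℂ³`-valued function on `P`. -/
def differential (z : P → Fin 3 → ℂ) (q : P) (v : TangentSpace (𝓡 6) q) : Fin 3 → ℂ :=
  mfderiv (𝓡 6) 𝓘(ℝ, Fin 3 → ℂ) z q v

/-- A field `J` of endomorphisms of the tangent spaces of a 6-manifold is integrable if it is the
multiplication by `i` of a complex structure: around every point there are smooth coordinates
`z : P ⊇ U ≅ z(U) ⊆ ℂ³` with `dz ∘ J = i dz`. -/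
def IsIntegrable (J : ∀ p : P, TangentSpace (𝓡 6) p →ₗ[ℝ] TangentSpace (𝓡 6) p) : Prop :=
  ∀ p : P, ∃ z : OpenPartialHomeomorph P (Fin 3 → ℂ), p ∈ z.source ∧
    ContMDiffOn (𝓡 6) 𝓘(ℝ, Fin 3 → ℂ) ∞ z z.source ∧
    ContMDiffOn 𝓘(ℝ, Fin 3 → ℂ) (𝓡 6) ∞ z.symm z.target ∧
    ∀ q ∈ z.source, ∀ v : TangentSpace (𝓡 6) q,
      differential z q (J q v) = Complex.I • differential z q v

end Forms

/-! ### Principal `SU(2)` bundles, connections and frames -/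

/-- A smooth principal `SU(2)` bundle `P → M` with 6-dimensional total space and 3-dimensional
base. The right action is smooth because it is the right multiplication in the smooth local
trivialisations. -/
structure PrincipalBundle (P M : Type*) [TopologicalSpace P] [ChartedSpace R6 P]
    [TopologicalSpace M] [ChartedSpace (EuclideanSpace ℝ (Fin 3)) M] where
  /-- the projection to the base -/
  proj : P → M
  /-- the right action -/
  act : P → SU2 → P
  act_one : ∀ p, act p 1 = p
  act_mul : ∀ p g h, act p (g * h) = act (act p g) h
  proj_act : ∀ p g, proj (act p g) = proj p
  exists_trivialization : ∀ x : M, ∃ (U : Set M) (e : OpenPartialHomeomorph P (M × SU2)),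
    IsOpen U ∧ x ∈ U ∧ e.source = proj ⁻¹' U ∧ e.target = U ×ˢ Set.univ ∧
    ContMDiffOn (𝓡 6) ((𝓡 3).prod (𝓡 3)) ∞ e e.source ∧
    ContMDiffOn ((𝓡 3).prod (𝓡 3)) (𝓡 6) ∞ e.symm e.target ∧
    ∀ p ∈ e.source, (e p).1 = proj p ∧ ∀ g, e (act p g) = ((e p).1, (e p).2 * g)

section Connections

variable {P M : Type*} [TopologicalSpace P] [ChartedSpace R6 P] [IsManifold (𝓡 6) ∞ P]
  [TopologicalSpace M] [ChartedSpace (EuclideanSpace ℝ (Fin 3)) M]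

/-- A 1-form on `P` is `SU(2)`-equivariant: `R_g^* α = g⁻¹ α g`. -/
def Equivariant (B : PrincipalBundle P M) (α : Form1 P) : Prop :=
  ∀ (g : SU2) (p : P) (v : TangentSpace (𝓡 6) p),
    α (B.act p g) (mfderiv (𝓡 6) (𝓡 6) (fun q => B.act q g) p v) =
      (g⁻¹ : SU2).1 * α p v * g.1

/-- A connection in a principal `SU(2)` bundle, as an `su(2)`-valued 1-form on the total space.
It is equivariant and restricts on the orbits to the Maurer-Cartan form: the tangent vector of
`g ↦ p g` at `g = 1` in the direction `X` is sent to the matrix `X`. -/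
structure Connection (B : PrincipalBundle P M) where
  /-- the connection 1-form `W` -/
  form : Form1 P
  smooth : IsSmooth form
  mem_su2 : ∀ p v, form p v ∈ su2
  equivariant : Equivariant B form
  vertical : ∀ (p : P) (X : TangentSpace (𝓡 3) (1 : SU2)),
    form p (mfderiv (𝓡 3) (𝓡 6) (fun g : SU2 => B.act p g) 1 X) =
      tangentMatrix X

/-- A frame `E` on the total space: a smooth equivariant `su(2)`-valued 1-form that vanishes on
vertical vectors and is injective on the horizontal ones, so that `-2 Tr (E ⊗ E)` is the lift
of a Riemannian metric on the base. -/
structure Frame (B : PrincipalBundle P M) (W : Connection B) where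
  /-- the 1-form `E` -/
  form : Form1 P
  smooth : IsSmooth form
  mem_su2 : ∀ p v, form p v ∈ su2
  equivariant : Equivariant B form
  horizontal : ∀ (p : P) (v : TangentSpace (𝓡 6) p),
    mfderiv (𝓡 6) (𝓡 3) B.proj p v = 0 → form p v = 0
  nondegenerate : ∀ (p : P) (v : TangentSpace (𝓡 6) p),
    W.form p v = 0 → form p v = 0 → v = 0

variable {B : PrincipalBundle P M} {W : Connection B}

/-- The coframe `v ↦ ((Wⁱ v)ᵢ, (Eⁱ v)ᵢ)` at `p`. -/
def coframe (E : Frame B W) (p : P) :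
    TangentSpace (𝓡 6) p →ₗ[ℝ] (Fin 3 → ℝ) × (Fin 3 → ℝ) :=
  (LinearMap.pi fun i => comp i ∘ₗ W.form p).prod
    (LinearMap.pi fun i => comp i ∘ₗ E.form p)

theorem coframe_bijective (E : Frame B W) (p : P) : Function.Bijective (coframe E p) := by
  have hinj : Function.Injective (coframe E p) := by
    rw [injective_iff_map_eq_zero]
    intro v hv
    have h1 (i : Fin 3) : comp i (W.form p v) = 0 := congrFun (congrArg Prod.fst hv) i
    have h2 (i : Fin 3) : comp i (E.form p v) = 0 := congrFun (congrArg Prod.snd hv) i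
    refine E.nondegenerate p v ?_ ?_
    · rw [← sum_comp_tau (W.mem_su2 p v)]; simp [h1]
    · rw [← sum_comp_tau (E.mem_su2 p v)]; simp [h2]
  have hfin : Module.finrank ℝ (TangentSpace (𝓡 6) p) =
      Module.finrank ℝ ((Fin 3 → ℝ) × (Fin 3 → ℝ)) := by
    change Module.finrank ℝ R6 = _
    simp
  have : FiniteDimensional ℝ (TangentSpace (𝓡 6) p) :=
    inferInstanceAs (FiniteDimensional ℝ R6)
  exact ⟨hinj, (LinearMap.injective_iff_surjective_of_finrank_eq_finrank hfin).1 hinj⟩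

/-- The coframe as a linear isomorphism. -/
def coframeEquiv (E : Frame B W) (p : P) :
    TangentSpace (𝓡 6) p ≃ₗ[ℝ] (Fin 3 → ℝ) × (Fin 3 → ℝ) :=
  LinearEquiv.ofBijective (coframe E p) (coframe_bijective E p)

/-- The dual vector `∂/∂Wⁱ`: `Wʲ (∂/∂Wⁱ) = δᵢʲ` and `Eʲ (∂/∂Wⁱ) = 0`. -/
def dualW (E : Frame B W) (p : P) (i : Fin 3) : TangentSpace (𝓡 6) p :=
  (coframeEquiv E p).symm (Pi.single i 1, 0)

/-- The dual vector `∂/∂Eⁱ`: `Wʲ (∂/∂Eⁱ) = 0` and `Eʲ (∂/∂Eⁱ) = δᵢʲ`. -/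
def dualE (E : Frame B W) (p : P) (i : Fin 3) : TangentSpace (𝓡 6) p :=
  (coframeEquiv E p).symm (0, Pi.single i 1)

/-- The almost-complex structure `J_{E,W} = ∑ᵢ Eⁱ ⊗ ∂/∂Wⁱ - Wⁱ ⊗ ∂/∂Eⁱ`. -/
def almostComplex (E : Frame B W) (p : P) :
    TangentSpace (𝓡 6) p →ₗ[ℝ] TangentSpace (𝓡 6) p :=
  ∑ i, ((comp i ∘ₗ E.form p).smulRight (dualW E p i) -
    (comp i ∘ₗ W.form p).smulRight (dualE E p i))

theorem coframe_almostComplex (E : Frame B W) (p : P) (v : TangentSpace (𝓡 6) p) :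
    coframe E p (almostComplex E p v) = ((coframe E p v).2, -(coframe E p v).1) := by
  have hW (i : Fin 3) : coframe E p (dualW E p i) = (Pi.single i 1, 0) :=
    (coframeEquiv E p).apply_symm_apply _
  have hE (i : Fin 3) : coframe E p (dualE E p i) = (0, Pi.single i 1) :=
    (coframeEquiv E p).apply_symm_apply _
  simp only [almostComplex, LinearMap.sum_apply, map_sum, LinearMap.sub_apply, map_sub,
    LinearMap.smulRight_apply, map_smul, hW, hE]
  ext j <;> simp [Prod.fst_sum, Prod.snd_sum, Finset.sum_apply, Pi.single_apply, coframe]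

/-- `J_{E,W}` is an almost-complex structure: its square is `-1`. -/
theorem almostComplex_sq (E : Frame B W) (p : P) (v : TangentSpace (𝓡 6) p) :
    almostComplex E p (almostComplex E p v) = -v := by
  apply (coframe_bijective E p).1
  rw [coframe_almostComplex, coframe_almostComplex, map_neg]
  rfl

/-- The complex 1-form `A = W + i E`. -/
def complexConnection (E : Frame B W) : Form1 P := fun p =>
  W.form p + Complex.I • E.form p

end Connections

end SU2Lift

end

noncomputable section

namespace SU2Lift

/-! ### Parallel sections of flat connections on trivial bundles -/

section Parallel

set_option maxSynthPendingDepth 3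

variable {V E : Type*} [NormedAddCommGroup V] [NormedSpace ℝ V]
  [NormedAddCommGroup E] [NormedSpace ℝ E]

/-! The proof rests on the identity `A ∘ J = -i A` (`complexConnection_almostComplex`): the entries
of `A = W + iE` are forms of type (0,1) for `J`. Since `A` is trace-free and injective on each
tangent space, three of its entries determine it, and their conjugates form a (1,0) coframe.

Integrable implies flat. In holomorphic coordinates the differential of a (0,1) form has no (2,0)
part (`extD_of_antilinear`), and neither has `A ∧ A`, so `F(A)` has none. Moreover `F(A)` vanishes
as soon as one argument is vertical, by equivariance and the Maurer–Cartan condition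
(`extD_fundamental`). As `J` maps horizontal vectors to vertical ones, on horizontal `u, v` the
vanishing (2,0) part reduces to the single term `F(A)(u, v)`. Hence `F(A) = 0`.

Flat implies integrable. If `F(A) = 0`, the equation `dg = g A` has a local matrix solution with `g
= 1` at a given point, one row at a time (`exists_parallel`). The conjugates of three entries of `g`
satisfy `dz ∘ J = i dz`, and the inverse function theorem makes them coordinates
(`isIntegrable_of_curvature_eq_zero`). The complex charts are thus explicit, and the
Newlander–Nirenberg theorem plays no role.

The second equivalence is the decomposition `F(A) = (F(W) - E ∧ E) + i ∇E`. Both `F(W) - E ∧ E` and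
`∇E` are `su(2)`-valued, and `su(2) ∩ i su(2) = 0`, so `F(A)` vanishes exactly when both of them do.
-/

theorem norm_le_two_mul_of_norm_deriv_le {f f' : ℝ → E} {ε : ℝ} (hε : 0 ≤ ε)
    (hf : ∀ t ∈ Set.Icc (0 : ℝ) 1, HasDerivWithinAt f (f' t) (Set.Icc 0 1) t)
    (h0 : f 0 = 0) (hb : ∀ t ∈ Set.Icc (0 : ℝ) 1, ‖f' t‖ ≤ ‖f t‖ + ε)
    {t : ℝ} (ht : t ∈ Set.Icc (0 : ℝ) 1) : ‖f t‖ ≤ 2 * ε := by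
  have h := norm_le_gronwallBound_of_norm_deriv_right_le (f := f) (f' := f') (δ := 0) (K := 1)
    (ε := ε) (a := 0) (b := 1) (fun t ht => (hf t ht).continuousWithinAt)
    (fun t ht => (hf t ⟨ht.1, ht.2.le⟩).mono_of_mem_nhdsWithin
      (Icc_mem_nhdsGE_of_mem ht)) (by simp [h0])
    (fun t ht => by simpa using hb t ⟨ht.1, ht.2.le⟩) t ht
  rw [gronwallBound_of_K_ne_0 one_ne_zero] at h
  simp only [zero_mul, zero_add, one_mul, sub_zero, div_one] at h
  -- Grönwall gives the bound `ε (exp t - 1)`, and `e < 3` turns it into `2 ε`.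
  have he : Real.exp t ≤ 3 := by
    have h1 : Real.exp t ≤ Real.exp 1 := Real.exp_le_exp.2 ht.2
    have := Real.exp_one_lt_d9
    linarith
  nlinarith

/-- A linear differential equation with small coefficients is solvable on the unit interval. -/
theorem exists_linear_ode_solution [CompleteSpace E] {A : ℝ → E →L[ℝ] E}
    (hA : ContinuousOn A (Set.Icc 0 1)) (hb : ∀ t ∈ Set.Icc (0 : ℝ) 1, ‖A t‖ ≤ 1 / 2) (e : E) :
    ∃ f : ℝ → E, f 0 = e ∧
      (∀ t ∈ Set.Icc (0 : ℝ) 1, HasDerivWithinAt f (A t (f t)) (Set.Icc 0 1) t) ∧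
      ∀ t ∈ Set.Icc (0 : ℝ) 1, ‖f t‖ ≤ 2 * ‖e‖ := by
  -- On the ball of radius `‖e‖ + 1` about `e` the field has norm at most `(2‖e‖ + 1) / 2 ≤ ‖e‖ +
  -- 1`, so one Picard–Lindelöf step covers all of `[0, 1]`.
  have hPL : IsPicardLindelof (fun t v => A t v) (tmin := 0) (tmax := 1)
      ⟨0, by simp⟩ e (‖e‖₊ + 1) 0 (‖e‖₊ + 1) 1 := by
    constructor
    · intro t ht
      refine ((A t).lipschitz.weaken ?_).lipschitzOnWith
      rw [← NNReal.coe_le_coe]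
      have := hb t ht
      simp only [coe_nnnorm, NNReal.coe_one]
      linarith
    · intro v _
      exact hA.clm_apply continuousOn_const
    · intro t ht v hv
      rw [mem_closedBall_iff_norm] at hv
      have h1 : ‖v‖ ≤ ‖v - e‖ + ‖e‖ := by simpa using norm_add_le (v - e) e
      have h2 := (A t).le_opNorm v
      have h3 := hb t ht
      push_cast at hv ⊢
      nlinarith [norm_nonneg v, norm_nonneg e]
    · simp
  obtain ⟨f, hf0, hf⟩ := hPL.exists_eq_forall_mem_Icc_hasDerivWithinAt₀
  refine ⟨f, hf0, hf, fun t ht => ?_⟩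
  have h := norm_le_two_mul_of_norm_deriv_le (f := fun t => f t - e) (f' := fun t => A t (f t))
    (ε := ‖e‖ / 2) (by positivity) (fun t ht => (hf t ht).sub_const e) (sub_eq_zero.2 hf0)
    (fun t ht => by
      have h1 : ‖f t‖ ≤ ‖f t - e‖ + ‖e‖ := by simpa using norm_add_le (f t - e) e
      have h2 := (A t).le_opNorm (f t)
      have h3 := hb t ht
      nlinarith [norm_nonneg (f t), norm_nonneg e, norm_nonneg (f t - e)]) ht
  have h1 : ‖f t‖ ≤ ‖f t - e‖ + ‖e‖ := by simpa using norm_add_le (f t - e) e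
  linarith

/-- Quantitative form: the radial parallel transport of a flat connection is parallel. -/
theorem exists_parallel_of_bounds [CompleteSpace E]
    {B : V → V →L[ℝ] E →L[ℝ] E} {B' : V → V →L[ℝ] V →L[ℝ] E →L[ℝ] E} {r C : ℝ}
    (hr : 0 < r) (hr1 : r ≤ 1) (hC : 0 ≤ C) (hCr : C * r ≤ 1 / 2)
    (hB : ∀ x ∈ Metric.ball (0 : V) r, HasFDerivAt B (B' x) x)
    (hb : ∀ x ∈ Metric.ball (0 : V) r, ‖B x‖ ≤ C)
    (hb' : ∀ x ∈ Metric.ball (0 : V) r, ‖B' x‖ ≤ C)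
    (hl : ∀ x ∈ Metric.ball (0 : V) r, ∀ y ∈ Metric.ball (0 : V) r, ‖B' y - B' x‖ ≤ C * ‖y - x‖)
    (hflat : ∀ x ∈ Metric.ball (0 : V) r, ∀ u v e,
      B' x u v e - B' x v u e + B x v (B x u e) - B x u (B x v e) = 0) (e : E) :
    ∃ f : V → E, f 0 = e ∧
      ∀ x ∈ Metric.ball (0 : V) r, HasFDerivAt f ((B x).flip (f x)) x := by
  have hconv : Convex ℝ (Metric.ball (0 : V) r) := convex_ball 0 r
  have hsm {x : V} (hx : x ∈ Metric.ball (0 : V) r) {t : ℝ} (ht : t ∈ Set.Icc (0 : ℝ) 1) :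
      t • x ∈ Metric.ball (0 : V) r := by
    rw [mem_ball_zero_iff] at hx ⊢
    rw [norm_smul, Real.norm_of_nonneg ht.1]
    nlinarith [norm_nonneg x, ht.2, ht.1]
  have hnr {x : V} (hx : x ∈ Metric.ball (0 : V) r) : ‖x‖ ≤ r := (mem_ball_zero_iff.1 hx).le
  have hn1 {x : V} (hx : x ∈ Metric.ball (0 : V) r) : ‖x‖ ≤ 1 := (hnr hx).trans hr1
  have hhalf {x : V} (hx : x ∈ Metric.ball (0 : V) r) {t : ℝ} (ht : t ∈ Set.Icc (0 : ℝ) 1) :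
      ‖B (t • x) x‖ ≤ 1 / 2 := by
    refine ((B (t • x)).le_opNorm x).trans (le_trans ?_ hCr)
    exact mul_le_mul (hb _ (hsm hx ht)) (hnr hx) (norm_nonneg _) hC
  have hpath (x : V) (t : ℝ) : HasDerivAt (fun s : ℝ => s • x) x t := by
    simpa using (hasDerivAt_id t).smul_const x
  have hBpath {x : V} (hx : x ∈ Metric.ball (0 : V) r) {t : ℝ} (ht : t ∈ Set.Icc (0 : ℝ) 1) :
      HasDerivAt (fun s : ℝ => B (s • x)) (B' (t • x) x) t :=
    (hB _ (hsm hx ht)).comp_hasDerivAt t (hpath x t)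
  -- `G x` is the parallel transport of `e` along the ray `t ↦ t • x`. Outside the ball it takes a
  -- dummy value, so that `choose` applies to all `x`.
  have hex (x : V) : ∃ G : ℝ → E, x ∈ Metric.ball (0 : V) r → G 0 = e ∧
      (∀ t ∈ Set.Icc (0 : ℝ) 1, HasDerivWithinAt G (B (t • x) x (G t)) (Set.Icc 0 1) t) ∧
      ∀ t ∈ Set.Icc (0 : ℝ) 1, ‖G t‖ ≤ 2 * ‖e‖ := by
    by_cases hx : x ∈ Metric.ball (0 : V) r
    · obtain ⟨G, hG⟩ := exists_linear_ode_solution (A := fun t => B (t • x) x)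
        (fun t ht => ((hBpath hx ht).continuousAt.continuousWithinAt).clm_apply
          continuousWithinAt_const) (fun t ht => hhalf hx ht) e
      exact ⟨G, fun _ => hG⟩
    · exact ⟨0, fun h => absurd h hx⟩
  choose G hG using hex
  have hlip {x y : V} (hx : x ∈ Metric.ball (0 : V) r) (hy : y ∈ Metric.ball (0 : V) r) :
      ‖B y - B x‖ ≤ C * ‖y - x‖ :=
    hconv.norm_image_sub_le_of_norm_hasFDerivWithin_le
      (fun z hz => (hB z hz).hasFDerivWithinAt) hb' hx hy
  have htaylor {x y : V} (hx : x ∈ Metric.ball (0 : V) r) (hy : y ∈ Metric.ball (0 : V) r) :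
      ‖B y - B x - B' x (y - x)‖ ≤ C * ‖y - x‖ * ‖y - x‖ := by
    have hs : segment ℝ x y ⊆ Metric.ball (0 : V) r := hconv.segment_subset hx hy
    refine (convex_segment x y).norm_image_sub_le_of_norm_hasFDerivWithin_le'
      (fun z hz => (hB z (hs hz)).hasFDerivWithinAt) (fun z hz => ?_)
      (left_mem_segment ℝ x y) (right_mem_segment ℝ x y)
    refine (hl x hx z (hs hz)).trans ?_
    gcongr
    exact norm_sub_le_of_mem_segment hz
  have hdiff {x y : V} (hx : x ∈ Metric.ball (0 : V) r) (hy : y ∈ Metric.ball (0 : V) r)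
      {t : ℝ} (ht : t ∈ Set.Icc (0 : ℝ) 1) :
      ‖G y t - G x t‖ ≤ 2 * (2 * C * ‖y - x‖ * (2 * ‖e‖)) := by
    refine norm_le_two_mul_of_norm_deriv_le (f := fun t => G y t - G x t) (by positivity)
      (fun t ht => ((hG y hy).2.1 t ht).sub ((hG x hx).2.1 t ht))
      (by simp [(hG x hx).1, (hG y hy).1]) (fun t ht => ?_) ht
    have h1 : B (t • y) y (G y t) - B (t • x) x (G x t) =
        B (t • x) x (G y t - G x t) + ((B (t • y) - B (t • x)) y + B (t • x) (y - x)) (G y t) := by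
      simp only [map_sub, _root_.add_apply, _root_.sub_apply]
      abel
    have h2 : ‖B (t • x) x (G y t - G x t)‖ ≤ ‖G y t - G x t‖ := by
      refine ((B (t • x) x).le_opNorm _).trans ?_
      nlinarith [hhalf hx ht, norm_nonneg (G y t - G x t)]
    have h3 : ‖(B (t • y) - B (t • x)) y‖ ≤ C * ‖y - x‖ := by
      refine ((B (t • y) - B (t • x)).le_opNorm y).trans ?_
      have h4 := hlip (hsm hx ht) (hsm hy ht)
      rw [← smul_sub, norm_smul, Real.norm_of_nonneg ht.1] at h4
      have h5 : C * (t * ‖y - x‖) ≤ C * ‖y - x‖ := by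
        gcongr
        nlinarith [norm_nonneg (y - x), ht.2]
      nlinarith [hn1 hy, norm_nonneg y, norm_nonneg (B (t • y) - B (t • x))]
    have h4 : ‖B (t • x) (y - x)‖ ≤ C * ‖y - x‖ :=
      ((B (t • x)).le_opNorm _).trans (by gcongr; exact hb _ (hsm hx ht))
    have h5 : ‖((B (t • y) - B (t • x)) y + B (t • x) (y - x)) (G y t)‖ ≤
        2 * C * ‖y - x‖ * (2 * ‖e‖) := by
      refine (ContinuousLinearMap.le_opNorm _ _).trans ?_
      refine mul_le_mul ?_ ((hG y hy).2.2 t ht) (norm_nonneg _) (by positivity)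
      refine (norm_add_le _ _).trans ?_
      linarith
    rw [h1]
    exact (norm_add_le _ _).trans (add_le_add h2 h5)
  -- The candidate derivative of `x ↦ G x t` in direction `k = y - x` is `t • B (t • x) k (G x t)`.
  -- Flatness makes it solve the equation of `G` linearised along the ray, up to terms that the
  -- remainder absorbs. Grönwall then bounds the remainder by a multiple of `‖k‖ ^ 2`: the terms
  -- `h5` and `h8` below supply `4 C` and `16 C * C`.
  have hmain {x y : V} (hx : x ∈ Metric.ball (0 : V) r) (hy : y ∈ Metric.ball (0 : V) r) :
      ‖G y 1 - G x 1 - B x (y - x) (G x 1)‖ ≤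
        2 * ((4 * C + 16 * C * C) * ‖e‖ * ‖y - x‖ ^ 2) := by
    have h := norm_le_two_mul_of_norm_deriv_le
      (f := fun t => G y t - G x t - t • B (t • x) (y - x) (G x t))
      (f' := fun t => B (t • y) y (G y t) - B (t • x) x (G x t) -
        (t • ((B' (t • x) x) (y - x) (G x t) + B (t • x) (y - x) (B (t • x) x (G x t))) +
          (1 : ℝ) • B (t • x) (y - x) (G x t)))
      (ε := (4 * C + 16 * C * C) * ‖e‖ * ‖y - x‖ ^ 2) (by positivity)
      (fun t ht => (((hG y hy).2.1 t ht).sub ((hG x hx).2.1 t ht)).sub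
        ((hasDerivAt_id t).hasDerivWithinAt.smul
          ((((hBpath hx ht).clm_apply (hasDerivAt_const t (y - x))).hasDerivWithinAt.congr_deriv
            (by simp)).clm_apply ((hG x hx).2.1 t ht))))
      (by simp [(hG x hx).1, (hG y hy).1]) (fun t ht => ?_) (t := 1) (by simp)
    · simpa using h
    set k := y - x with hk
    have hfl := hflat (t • x) (hsm hx ht) k x (G x t)
    have h1 : B (t • y) y (G y t) - B (t • x) x (G x t) -
        (t • ((B' (t • x) x) k (G x t) + B (t • x) k (B (t • x) x (G x t))) +
          (1 : ℝ) • B (t • x) k (G x t)) =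
        B (t • x) x (G y t - G x t - t • B (t • x) k (G x t)) +
        ((B (t • y) - B (t • x)) k + (B (t • y) - B (t • x) - B' (t • x) (t • k)) x) (G y t) +
        (B (t • x) k + t • B' (t • x) k x) (G y t - G x t) := by
      have hy' : y = x + k := by rw [hk]; abel
      -- Flatness exchanges the derivative of `B` along the ray for the derivative in direction `k`,
      -- which is the one produced by varying the endpoint.
      have hfl' : B' (t • x) x k (G x t) = B' (t • x) k x (G x t) + B (t • x) x (B (t • x) k (G x t))
          - B (t • x) k (B (t • x) x (G x t)) := by
        rw [← sub_eq_zero, ← neg_eq_zero, ← hfl]; abel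
      rw [hfl']
      have e1 : B (t • y) y (G y t) = B (t • y) x (G y t) + B (t • y) k (G y t) := by
        conv_lhs => rw [hy']
        rw [hy', map_add]; rfl
      rw [e1]
      simp only [map_sub, map_smul, _root_.add_apply,
        _root_.sub_apply, _root_.smul_apply, smul_add, smul_sub, one_smul]
      abel
    rw [h1]
    have h2 : ‖B (t • x) x (G y t - G x t - t • B (t • x) k (G x t))‖ ≤
        ‖G y t - G x t - t • B (t • x) k (G x t)‖ := by
      refine ((B (t • x) x).le_opNorm _).trans ?_
      nlinarith [hhalf hx ht, norm_nonneg (G y t - G x t - t • B (t • x) k (G x t))]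
    have htk : ‖t • y - t • x‖ ≤ ‖k‖ := by
      rw [← smul_sub, norm_smul, Real.norm_of_nonneg ht.1]
      nlinarith [norm_nonneg (y - x), ht.2]
    have h3 : ‖(B (t • y) - B (t • x)) k‖ ≤ C * ‖k‖ ^ 2 := by
      refine ((B (t • y) - B (t • x)).le_opNorm k).trans ?_
      rw [pow_two, ← mul_assoc]
      gcongr
      exact (hlip (hsm hx ht) (hsm hy ht)).trans (by gcongr)
    have h4 : ‖(B (t • y) - B (t • x) - B' (t • x) (t • k)) x‖ ≤ C * ‖k‖ ^ 2 := by
      refine (ContinuousLinearMap.le_opNorm _ x).trans ?_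
      have h5 := htaylor (hsm hx ht) (hsm hy ht)
      rw [← smul_sub, ← hk] at h5
      rw [← smul_sub, ← hk] at htk
      have h6 : C * ‖t • k‖ * ‖t • k‖ ≤ C * ‖k‖ ^ 2 := by
        rw [pow_two, ← mul_assoc]; gcongr
      nlinarith [hn1 hx, norm_nonneg x, norm_nonneg (B (t • y) - B (t • x) - B' (t • x) (t • k))]
    have h5 : ‖((B (t • y) - B (t • x)) k + (B (t • y) - B (t • x) - B' (t • x) (t • k)) x)
        (G y t)‖ ≤ 2 * (C * ‖k‖ ^ 2) * (2 * ‖e‖) := by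
      refine (ContinuousLinearMap.le_opNorm _ _).trans ?_
      refine mul_le_mul ?_ ((hG y hy).2.2 t ht) (norm_nonneg _) (by positivity)
      refine (norm_add_le _ _).trans ?_
      linarith
    have h6 : ‖B (t • x) k‖ ≤ C * ‖k‖ :=
      ((B (t • x)).le_opNorm _).trans (by gcongr; exact hb _ (hsm hx ht))
    have h7 : ‖t • B' (t • x) k x‖ ≤ C * ‖k‖ := by
      rw [norm_smul, Real.norm_of_nonneg ht.1]
      have h8 : ‖B' (t • x) k‖ ≤ C * ‖k‖ :=
        ((B' (t • x)).le_opNorm _).trans (by gcongr; exact hb' _ (hsm hx ht))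
      have h9 : ‖B' (t • x) k x‖ ≤ C * ‖k‖ :=
        ((B' (t • x) k).le_opNorm _).trans (by nlinarith [hn1 hx, norm_nonneg x, norm_nonneg (B' (t • x) k)])
      nlinarith [ht.1, ht.2, norm_nonneg (B' (t • x) k x)]
    have h8 : ‖(B (t • x) k + t • B' (t • x) k x) (G y t - G x t)‖ ≤
        2 * (C * ‖k‖) * (2 * (2 * C * ‖k‖ * (2 * ‖e‖))) := by
      refine (ContinuousLinearMap.le_opNorm _ _).trans ?_
      refine mul_le_mul ?_ (hdiff hx hy ht) (norm_nonneg _) (by positivity)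
      refine (norm_add_le _ _).trans ?_
      linarith
    refine (norm_add_le _ _).trans (le_trans (add_le_add (norm_add_le _ _) le_rfl) ?_)
    refine (add_le_add (add_le_add h2 h5) h8).trans (le_of_eq ?_)
    ring
  refine ⟨fun x => G x 1, ?_, fun x hx => ?_⟩
  · have h0 : (0 : V) ∈ Metric.ball (0 : V) r := Metric.mem_ball_self hr
    have h := norm_le_two_mul_of_norm_deriv_le (f := fun t => G 0 t - e) (ε := 0) le_rfl
      (fun t ht => ((hG 0 h0).2.1 t ht).sub_const e) (by simp [(hG 0 h0).1])
      (fun t ht => by simp) (t := 1) (by simp)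
    rw [mul_zero, norm_le_zero_iff, sub_eq_zero] at h
    exact h
  · rw [hasFDerivAt_iff_isLittleO]
    have hO : (fun y => G y 1 - G x 1 - ((B x).flip (G x 1)) (y - x)) =O[nhds x]
        fun y => ‖y - x‖ ^ 2 := by
      refine Asymptotics.IsBigO.of_bound (2 * ((4 * C + 16 * C * C) * ‖e‖)) ?_
      filter_upwards [Metric.isOpen_ball.mem_nhds hx] with y hy
      refine (hmain hx hy).trans (le_of_eq ?_)
      rw [norm_pow, norm_norm]
      ring
    refine hO.trans_isLittleO ?_
    have : Filter.Tendsto (fun y => y - x) (nhds x) (nhds 0) := by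
      have : Continuous fun y : V => y - x := by fun_prop
      simpa using this.tendsto x
    exact (Asymptotics.isLittleO_norm_pow_id one_lt_two).comp_tendsto this

/-- A flat connection on a trivial bundle has parallel sections through every point. -/
theorem exists_parallel [CompleteSpace E] {B : V → V →L[ℝ] E →L[ℝ] E} {x₀ : V}
    (hB : ContDiffAt ℝ 2 B x₀)
    (hflat : ∀ᶠ x in nhds x₀, ∀ u v e, fderiv ℝ B x u v e - fderiv ℝ B x v u e +
      B x v (B x u e) - B x u (B x v e) = 0) (e : E) :
    ∃ f : V → E, f x₀ = e ∧ ∀ᶠ x in nhds x₀, HasFDerivAt f ((B x).flip (f x)) x := by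
  have hd : ∀ᶠ x in nhds x₀, DifferentiableAt ℝ B x :=
    (hB.eventually (by simp)).mono fun x hx => hx.differentiableAt (by simp)
  have hB' : ContDiffAt ℝ 1 (fderiv ℝ B) x₀ := hB.fderiv_right (by norm_num)
  obtain ⟨K, s, hs, hK⟩ := hB'.exists_lipschitzOnWith
  have hbd : ∀ᶠ x in nhds x₀, ‖B x‖ ≤ ‖B x₀‖ + 1 :=
    (hB.continuousAt.norm.eventually_lt_const (lt_add_one _)).mono fun _ h => h.le
  have hbd' : ∀ᶠ x in nhds x₀, ‖fderiv ℝ B x‖ ≤ ‖fderiv ℝ B x₀‖ + 1 :=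
    (hB'.continuousAt.norm.eventually_lt_const (lt_add_one _)).mono fun _ h => h.le
  obtain ⟨R, hR, hball⟩ := Metric.eventually_nhds_iff_ball.1
    (hd.and (hbd.and (hbd'.and (hflat.and hs))))
  set C : ℝ := max (max (‖B x₀‖ + 1) (‖fderiv ℝ B x₀‖ + 1)) K with hCdef
  have hC1 : ‖B x₀‖ + 1 ≤ C := (le_max_left _ _).trans (le_max_left _ _)
  have hC2 : ‖fderiv ℝ B x₀‖ + 1 ≤ C := (le_max_right _ _).trans (le_max_left _ _)
  have hC3 : (K : ℝ) ≤ C := le_max_right _ _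
  have hC : 0 < C := lt_of_lt_of_le (by positivity) hC1
  -- The bound `1 / (2 * C)` gives `C * r ≤ 1 / 2`, the smallness needed to integrate along each ray
  -- up to time 1.
  set r : ℝ := min R (min 1 (1 / (2 * C))) with hrdef
  have hr : 0 < r := lt_min hR (lt_min one_pos (by positivity))
  have hmem {x : V} (hx : x ∈ Metric.ball (0 : V) r) : x₀ + x ∈ Metric.ball x₀ R := by
    rw [mem_ball_zero_iff] at hx
    rw [mem_ball_iff_norm, add_sub_cancel_left]
    exact hx.trans_le (min_le_left _ _)
  have hshift (x : V) : HasFDerivAt (fun x => x₀ + x) (ContinuousLinearMap.id ℝ V) x :=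
    (hasFDerivAt_id x).const_add x₀
  obtain ⟨f, hf0, hf⟩ := exists_parallel_of_bounds (B := fun x => B (x₀ + x))
    (B' := fun x => fderiv ℝ B (x₀ + x)) (r := r) (C := C) hr
    ((min_le_right _ _).trans (min_le_left _ _)) hC.le
    (by
      have h : r ≤ 1 / (2 * C) := (min_le_right _ _).trans (min_le_right _ _)
      calc C * r ≤ C * (1 / (2 * C)) := by gcongr
        _ = 1 / 2 := by field_simp)
    (fun x hx => (hball _ (hmem hx)).1.hasFDerivAt.comp x (hshift x))
    (fun x hx => (hball _ (hmem hx)).2.1.trans hC1)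
    (fun x hx => (hball _ (hmem hx)).2.2.1.trans hC2)
    (fun x hx y hy => by
      have h := hK.norm_sub_le (hball _ (hmem hy)).2.2.2.2 (hball _ (hmem hx)).2.2.2.2
      rw [add_sub_add_left_eq_sub] at h
      exact h.trans (by gcongr))
    (fun x hx => (hball _ (hmem hx)).2.2.2.1) e
  refine ⟨fun x => f (x - x₀), by simpa using hf0, ?_⟩
  filter_upwards [Metric.ball_mem_nhds x₀ hr] with x hx
  have hx' : x - x₀ ∈ Metric.ball (0 : V) r := by
    rw [mem_ball_zero_iff]; exact mem_ball_iff_norm.1 hx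
  have h := (hf _ hx').comp x ((hasFDerivAt_id x).sub_const x₀)
  simpa [Function.comp_def] using h

end Parallel

/-! ### Pullbacks of forms and the exterior derivative -/

section Pullback

variable {P : Type*} [TopologicalSpace P] [ChartedSpace R6 P]
  {F : Type*} [NormedAddCommGroup F] [NormedSpace ℝ F]

/-- The value of `Φ^* α` at `x` on the vector `w`. -/
def pullback (α : Form1 P) (Φ : F → P) (x w : F) : Mat2 :=
  α (Φ x) (mfderiv 𝓘(ℝ, F) (𝓡 6) Φ x w)

/-- All tangent spaces are definitionally `R6`, so vectors at two equal base points can be compared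
there without transport. -/
theorem form_congr (α : Form1 P) {p q : P} (h : p = q) {v w : R6} (hvw : v = w) :
    α p v = α q w := by
  subst h hvw
  rfl

theorem pullback_add (α : Form1 P) (Φ : F → P) (x u v : F) :
    pullback α Φ x (u + v) = pullback α Φ x u + pullback α Φ x v :=
  (congrArg (α (Φ x)) ((mfderiv 𝓘(ℝ, F) (𝓡 6) Φ x).map_add u v)).trans ((α (Φ x)).map_add _ _)

theorem pullback_smul (α : Form1 P) (Φ : F → P) (x : F) (r : ℝ) (u : F) :
    pullback α Φ x (r • u) = r • pullback α Φ x u :=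
  (congrArg (α (Φ x)) ((mfderiv 𝓘(ℝ, F) (𝓡 6) Φ x).map_smul r u)).trans
    ((α (Φ x)).map_smul _ _)

/-- An entry of `Φ^* α` at `x` as a continuous linear form. -/
def pullbackCLM [FiniteDimensional ℝ F] (α : Form1 P) (Φ : F → P) (i j : Fin 2) (x : F) :
    F →L[ℝ] ℂ :=
  LinearMap.toContinuousLinearMap
    { toFun := fun w => pullback α Φ x w i j
      map_add' := fun u v => by rw [pullback_add]; rfl
      map_smul' := fun r u => by rw [pullback_smul]; rfl }

theorem pullbackCLM_apply [FiniteDimensional ℝ F] (α : Form1 P) (Φ : F → P) (i j : Fin 2)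
    (x w : F) : pullbackCLM α Φ i j x w = pullback α Φ x w i j := rfl

variable [IsManifold (𝓡 6) ∞ P]

theorem contDiffOn_pullback {α : Form1 P} (hα : IsSmooth α) {U : Set F} (hU : IsOpen U)
    {Φ : F → P} (hΦ : ContMDiffOn 𝓘(ℝ, F) (𝓡 6) ∞ Φ U) (w : F) (i j : Fin 2) :
    ContDiffOn ℝ ∞ (fun x => pullback α Φ x w i j) U := by
  have : IsManifold (𝓡 6) 1 P := IsManifold.of_le (n := ∞) (by simp)
  rw [← contMDiffOn_iff_contDiffOn]
  have h1 := hΦ.contMDiffOn_tangentMapWithin (m := ∞) (by simp) hU.uniqueMDiffOn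
  have h2 : ContMDiffOn 𝓘(ℝ, F) 𝓘(ℝ, F).tangent ∞
      (fun x => (⟨x, w⟩ : TangentBundle 𝓘(ℝ, F) F)) U := fun x _ =>
    ((contMDiffAt_vectorSpace_iff_contDiffAt (V := fun _ => w)).2
      contDiffAt_const).contMDiffWithinAt
  have h3 := (hα i j).comp_contMDiffOn (h1.comp h2 fun x hx => hx)
  refine h3.congr fun x hx => ?_
  have h4 : tangentMapWithin 𝓘(ℝ, F) (𝓡 6) Φ U (⟨x, w⟩ : TangentBundle 𝓘(ℝ, F) F) =
      tangentMap 𝓘(ℝ, F) (𝓡 6) Φ ⟨x, w⟩ :=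
    tangentMapWithin_eq_tangentMap (hU.uniqueMDiffOn x hx)
      ((hΦ.contMDiffAt (hU.mem_nhds hx)).mdifferentiableAt (by simp))
  simp only [Function.comp_apply]
  rw [h4]
  rfl

theorem contDiffOn_pullbackCLM [FiniteDimensional ℝ F] {α : Form1 P} (hα : IsSmooth α)
    {U : Set F} (hU : IsOpen U) {Φ : F → P} (hΦ : ContMDiffOn 𝓘(ℝ, F) (𝓡 6) ∞ Φ U)
    (i j : Fin 2) : ContDiffOn ℝ ∞ (pullbackCLM α Φ i j) U :=
  contDiffOn_clm_apply.2 fun w => contDiffOn_pullback hα hU hΦ w i j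

/-- The exterior derivative is natural with respect to smooth maps from vector spaces. -/
theorem extD_mfderiv {α : Form1 P} (hα : IsSmooth α) {U : Set F} (hU : IsOpen U)
    {Φ : F → P} (hΦ : ContMDiffOn 𝓘(ℝ, F) (𝓡 6) ∞ Φ U) {x : F} (hx : x ∈ U) (u v : F)
    (i j : Fin 2) :
    extD α (Φ x) (mfderiv 𝓘(ℝ, F) (𝓡 6) Φ x u) (mfderiv 𝓘(ℝ, F) (𝓡 6) Φ x v) i j =
      fderiv ℝ (fun y => pullback α Φ y v i j) x u -
        fderiv ℝ (fun y => pullback α Φ y u i j) x v := by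
  have : IsManifold (𝓡 6) 1 P := IsManifold.of_le (n := ∞) (by simp)
  set p : P := Φ x with hp
  set φ := extChartAt (𝓡 6) p with hφ
  set Θ : F → R6 := fun y => φ (Φ y) with hΘ
  have hsymm : ContMDiffOn 𝓘(ℝ, R6) (𝓡 6) ∞ φ.symm φ.target := contMDiffOn_extChartAt_symm p
  have hopen : IsOpen φ.target := isOpen_extChartAt_target p
  set a : R6 → R6 →L[ℝ] ℂ := pullbackCLM α φ.symm i j with ha
  have hsrc : ∀ᶠ y in nhds x, y ∈ U ∧ Φ y ∈ φ.source := by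
    refine Filter.Eventually.and (hU.mem_nhds hx) ?_
    exact (hΦ.contMDiffAt (hU.mem_nhds hx)).continuousAt.preimage_mem_nhds
      (extChartAt_source_mem_nhds p)
  have hΦd {y : F} (hy : y ∈ U) : MDifferentiableAt 𝓘(ℝ, F) (𝓡 6) Φ y :=
    (hΦ.contMDiffAt (hU.mem_nhds hy)).mdifferentiableAt (by simp)
  have hφd {q : P} (hq : q ∈ φ.source) : ContMDiffAt (𝓡 6) 𝓘(ℝ, R6) ∞ φ q :=
    contMDiffAt_extChartAt' (by rwa [hφ, extChartAt_source] at hq)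
  have hΘs {y : F} (hy : y ∈ U ∧ Φ y ∈ φ.source) : ContDiffAt ℝ ∞ Θ y :=
    ((hφd hy.2).comp y (hΦ.contMDiffAt (hU.mem_nhds hy.1))).contDiffAt
  have hΘd {y : F} (hy : y ∈ U ∧ Φ y ∈ φ.source) : DifferentiableAt ℝ Θ y :=
    (hΘs hy).differentiableAt (by simp)
  have hchart (w : F) : chartVector p (mfderiv 𝓘(ℝ, F) (𝓡 6) Φ x w) = fderiv ℝ Θ x w := by
    have h := mfderiv_comp_apply (I := 𝓘(ℝ, F)) (I' := 𝓡 6) (I'' := 𝓘(ℝ, R6)) x (g := φ) (f := Φ)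
      ((hφd hsrc.self_of_nhds.2).mdifferentiableAt (by simp)) (hΦd hx) w
    rw [mfderiv_eq_fderiv] at h
    exact h.symm
  have hpull {y : F} (hy : y ∈ U ∧ Φ y ∈ φ.source) (hy' : ∀ᶠ z in nhds y, Φ z ∈ φ.source)
      (w : F) : pullback α Φ y w i j = a (Θ y) (fderiv ℝ Θ y w) := by
    have hmem : Θ y ∈ φ.target := φ.map_source hy.2
    have h := mfderiv_comp_apply (I := 𝓘(ℝ, F)) (I' := 𝓘(ℝ, R6)) (I'' := 𝓡 6) y (g := φ.symm)
      (f := Θ) ((hsymm.contMDiffAt (hopen.mem_nhds hmem)).mdifferentiableAt (by simp))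
      (hΘd hy).mdifferentiableAt w
    have heq : φ.symm ∘ Θ =ᶠ[nhds y] Φ := hy'.mono fun z hz => φ.left_inv hz
    rw [heq.mfderiv_eq] at h
    rw [mfderiv_eq_fderiv] at h
    exact congrFun (congrFun (form_congr α (φ.left_inv hy.2).symm h) i) j
  have hxt : Θ x ∈ φ.target := φ.map_source hsrc.self_of_nhds.2
  have had : DifferentiableAt ℝ a (Θ x) :=
    ((contDiffOn_pullbackCLM hα hopen hsymm i j).contDiffAt
      (hopen.mem_nhds hxt)).differentiableAt (by simp)
  have hΘ2 : DifferentiableAt ℝ (fderiv ℝ Θ) x :=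
    ((hΘs hsrc.self_of_nhds).fderiv_right (m := 1) (by
      rw [one_add_one_eq_two]; exact WithTop.coe_le_coe.2 (le_top : (2 : ℕ∞) ≤ ⊤))).differentiableAt (by simp)
  have hev : ∀ᶠ y in nhds x, ∀ w, pullback α Φ y w i j = a (Θ y) (fderiv ℝ Θ y w) := by
    filter_upwards [hsrc.eventually_nhds] with y hy w
    exact hpull hy.self_of_nhds (hy.mono fun z hz => hz.2) w
  -- Near `x` the map `Φ` is `φ.symm ∘ Θ`, so the pulled-back form is `a (Θ y) (dΘ w)`. The product
  -- rule gives a tensorial term and one with the second derivative of `Θ`, which cancels on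
  -- antisymmetrising.
  have hder (w s : F) : fderiv ℝ (fun y => pullback α Φ y w i j) x s =
      fderiv ℝ a (Θ x) (fderiv ℝ Θ x s) (fderiv ℝ Θ x w) +
        a (Θ x) (fderiv ℝ (fderiv ℝ Θ) x s w) := by
    have h1 : (fun y => pullback α Φ y w i j) =ᶠ[nhds x] fun y => a (Θ y) (fderiv ℝ Θ y w) :=
      hev.mono fun y hy => hy w
    rw [h1.fderiv_eq]
    have h2 := ((had.hasFDerivAt.comp x (hΘd hsrc.self_of_nhds).hasFDerivAt).clm_apply
      (hΘ2.hasFDerivAt.clm_apply (hasFDerivAt_const w x)))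
    have h3 := h2.fderiv
    simp only [Function.comp_apply] at h3
    rw [h3]
    simp [add_comm]
  have hcoord (r s : R6) : coordDeriv α p r s i j = fderiv ℝ a (Θ x) r s := by
    have h := (had.hasFDerivAt.clm_apply (hasFDerivAt_const s (Θ x))).fderiv
    have h2 : coordDeriv α p r s i j = fderiv ℝ (fun y => a y s) (Θ x) r := rfl
    rw [h2, h]
    simp
  have hsym : fderiv ℝ (fderiv ℝ Θ) x u v = fderiv ℝ (fderiv ℝ Θ) x v u :=
    ((hΘs hsrc.self_of_nhds).isSymmSndFDerivAt (by
      simp only [minSmoothness_of_isRCLikeNormedField]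
      exact WithTop.coe_le_coe.2 (le_top : (2 : ℕ∞) ≤ ⊤))).eq u v
  have hext : extD α p (mfderiv 𝓘(ℝ, F) (𝓡 6) Φ x u) (mfderiv 𝓘(ℝ, F) (𝓡 6) Φ x v) i j =
      coordDeriv α p (chartVector p (mfderiv 𝓘(ℝ, F) (𝓡 6) Φ x u))
        (chartVector p (mfderiv 𝓘(ℝ, F) (𝓡 6) Φ x v)) i j -
      coordDeriv α p (chartVector p (mfderiv 𝓘(ℝ, F) (𝓡 6) Φ x v))
        (chartVector p (mfderiv 𝓘(ℝ, F) (𝓡 6) Φ x u)) i j := rfl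
  rw [hext, hchart, hchart, hcoord, hcoord, hder, hder, hsym]
  ring

end Pullback

/-! ### Smooth maps to and from `SU(2)` -/

/-- The charts of `SU2` are those of the sphere composed with `sphereHomeo`, so in charts the map is
the identity. -/
theorem contMDiff_sphereHomeo : ContMDiff (𝓡 3) (𝓡 3) ∞ sphereHomeo := by
  intro g
  rw [contMDiffAt_iff]
  refine ⟨sphereHomeo.continuous.continuousAt, ?_⟩
  refine contDiffWithinAt_id.congr_of_eventuallyEq_of_mem ?_ (by simp)
  filter_upwards [extChartAt_target_mem_nhdsWithin (I := 𝓡 3) g] with y hy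
  have h := (extChartAt (𝓡 3) g).right_inv hy
  exact h

theorem contMDiff_sphereHomeo_symm : ContMDiff (𝓡 3) (𝓡 3) ∞ sphereHomeo.symm := by
  intro x
  rw [contMDiffAt_iff]
  refine ⟨sphereHomeo.symm.continuous.continuousAt, ?_⟩
  refine contDiffWithinAt_id.congr_of_eventuallyEq_of_mem ?_ (by simp)
  filter_upwards [extChartAt_target_mem_nhdsWithin (I := 𝓡 3) x] with y hy
  have h := (extChartAt (𝓡 3) x).right_inv hy
  refine Eq.trans ?_ h
  have h2 (z : Metric.sphere (0 : R4) 1) :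
      extChartAt (𝓡 3) (sphereHomeo (sphereHomeo.symm x)) (sphereHomeo (sphereHomeo.symm z)) =
        extChartAt (𝓡 3) x z := by
    rw [sphereHomeo.apply_symm_apply, sphereHomeo.apply_symm_apply]
  exact h2 _

theorem contDiff_ofR4_entry (a b : Fin 2) : ContDiff ℝ ∞ fun x : R4 => ofR4 x a b := by
  have hx (i : Fin 4) : ContDiff ℝ ∞ fun x : R4 => x i := by fun_prop
  have hc (i j : Fin 4) : ContDiff ℝ ∞ fun x : R4 => (⟨x i, x j⟩ : ℂ) := by
    have : (fun x : R4 => (⟨x i, x j⟩ : ℂ)) =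
        fun x => Complex.ofRealCLM (x i) + Complex.ofRealCLM (x j) * Complex.I := by
      funext x
      apply Complex.ext <;> simp
    rw [this]
    exact (Complex.ofRealCLM.contDiff.comp (hx i)).add
      ((Complex.ofRealCLM.contDiff.comp (hx j)).mul contDiff_const)
  have hc' (i j : Fin 4) : ContDiff ℝ ∞ fun x : R4 => (⟨x i, -x j⟩ : ℂ) :=
    Complex.conjCLE.contDiff.comp (hc i j)
  fin_cases a <;> fin_cases b
  · exact hc 0 1
  · exact (hc' 2 3).neg
  · exact hc 2 3
  · exact hc' 0 1

theorem contMDiff_entry (a b : Fin 2) :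
    ContMDiff (𝓡 3) 𝓘(ℝ, ℂ) ∞ fun g : SU2 => g.1 a b := by
  have := Fact.mk (finrank_euclideanSpace_fin (𝕜 := ℝ) (n := 3 + 1))
  have h := (contDiff_ofR4_entry a b).contMDiff.comp
    ((contMDiff_coe_sphere (n := 3) (E := R4)).comp contMDiff_sphereHomeo)
  refine h.congr fun g => ?_
  exact congrFun (congrFun (ofR4_toR4 g).symm a) b

/-- `toR4` as a continuous linear map on arrays of complex numbers. -/
def toR4CLM : (Fin 2 → Fin 2 → ℂ) →L[ℝ] R4 :=
  LinearMap.toContinuousLinearMap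
    { toFun := fun g => toR4 (Matrix.of g)
      map_add' := fun g h => by ext i; fin_cases i <;> simp [toR4]
      map_smul' := fun r g => by ext i; fin_cases i <;> simp [toR4] }

section IntoSU2

variable {F H N : Type*} [NormedAddCommGroup F] [NormedSpace ℝ F] [TopologicalSpace H]
  {I : ModelWithCorners ℝ F H} [TopologicalSpace N] [ChartedSpace H N] [IsManifold I ∞ N]

/-- A map to `SU(2)` is smooth if its matrix entries are smooth. -/
theorem contMDiff_of_entries {f : N → SU2}
    (hf : ∀ a b : Fin 2, ContMDiff I 𝓘(ℝ, ℂ) ∞ fun x => (f x).1 a b) :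
    ContMDiff I (𝓡 3) ∞ f := by
  have h1 : ContMDiff I 𝓘(ℝ, R4) ∞ fun x => toR4 (f x).1 :=
    toR4CLM.contDiff.contMDiff.comp
      (contMDiff_pi_space.2 fun a => contMDiff_pi_space.2 fun b => hf a b)
  have := Fact.mk (finrank_euclideanSpace_fin (𝕜 := ℝ) (n := 3 + 1))
  have h2 := contMDiff_sphereHomeo_symm.comp
    (h1.codRestrict_sphere (n := 3) fun x => toR4_mem (f x))
  refine h2.congr fun x => ?_
  exact (sphereHomeo.symm_apply_apply (f x)).symm

end IntoSU2

theorem contMDiff_mul :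
    ContMDiff ((𝓡 3).prod (𝓡 3)) (𝓡 3) ∞ fun x : SU2 × SU2 => x.1 * x.2 := by
  refine contMDiff_of_entries fun a b => ?_
  have hm : ContDiff ℝ ∞ fun z : ℂ × ℂ => z.1 * z.2 := contDiff_fst.mul contDiff_snd
  have h (k : Fin 2) : ContMDiff ((𝓡 3).prod (𝓡 3)) 𝓘(ℝ, ℂ) ∞
      fun x : SU2 × SU2 => x.1.1 a k * x.2.1 k b :=
    hm.contMDiff.comp (((contMDiff_entry a k).comp contMDiff_fst).prodMk_space
      ((contMDiff_entry k b).comp contMDiff_snd))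
  refine ((h 0).add (h 1)).congr fun x => ?_
  simp [Matrix.mul_apply, Fin.sum_univ_two]

/-! ### Explicit curves in `SU(2)` through the identity -/

theorem ofR4_toR4_of_mem_su2 {X : Mat2} (hX : X ∈ su2) : ofR4 (toR4 X) = X := by
  obtain ⟨h, ht⟩ := hX
  have h00 := congrFun (congrFun h 0) 0
  have h01 := congrFun (congrFun h 0) 1
  simp [Complex.ext_iff] at h00 h01
  simp [Matrix.trace_fin_two, Complex.ext_iff] at ht
  ext i j
  fin_cases i <;> fin_cases j <;> simp [ofR4, toR4, Complex.ext_iff] <;>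
    (try constructor) <;> linarith

/-- The squared norm of an element of `su(2)` as a vector of `ℝ⁴`. -/
def sqNorm (X : Mat2) : ℝ := ‖toR4 X‖ ^ 2

/-- The factor normalising `1 + t X`. -/
def normFactor (X : Mat2) (t : ℝ) : ℝ := (Real.sqrt (1 + t ^ 2 * sqNorm X))⁻¹

theorem one_add_pos (X : Mat2) (t : ℝ) : 0 < 1 + t ^ 2 * sqNorm X := by
  unfold sqNorm; positivity

theorem normFactor_mul (X : Mat2) (t : ℝ) :
    normFactor X t * normFactor X t * (1 + t ^ 2 * sqNorm X) = 1 := by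
  have h := Real.mul_self_sqrt (one_add_pos X t).le
  have h2 : Real.sqrt (1 + t ^ 2 * sqNorm X) ≠ 0 := (Real.sqrt_pos.2 (one_add_pos X t)).ne'
  unfold normFactor
  nth_rewrite 3 [← h]
  field_simp

theorem contDiff_normFactor (X : Mat2) : ContDiff ℝ ∞ (normFactor X) := by
  unfold normFactor
  refine ContDiff.inv (ContDiff.sqrt (by fun_prop) fun t => (one_add_pos X t).ne') fun t => ?_
  exact (Real.sqrt_pos.2 (one_add_pos X t)).ne'

theorem normFactor_zero (X : Mat2) : normFactor X 0 = 1 := by simp [normFactor]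

theorem hasDerivAt_normFactor (X : Mat2) : HasDerivAt (normFactor X) 0 0 := by
  have h1 : HasDerivAt (fun t : ℝ => 1 + t ^ 2 * sqNorm X) 0 0 := by
    simpa using ((hasDerivAt_pow 2 (0 : ℝ)).mul_const (sqNorm X)).const_add 1
  have h2 := (h1.sqrt (by simp)).inv (by simp)
  exact h2.congr_deriv (by simp)

/-- `SU(2)` is the unit sphere of the quaternions, the image of `ofR4`, and `su(2)` is their
imaginary part. Hence `1 + t X` is a quaternion of squared norm `1 + t² |X|²`, and normalising it
gives an element of `SU(2)`. -/
theorem normFactor_smul_mem {X : Mat2} (hX : X ∈ su2) (t : ℝ) :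
    normFactor X t • (1 + t • X) ∈ Matrix.specialUnitaryGroup (Fin 2) ℂ := by
  have hlin : normFactor X t • (1 + t • X) =
      ofR4 (toR4 (normFactor X t • (1 + t • X))) := by
    generalize normFactor X t = c
    have h := ofR4_toR4_of_mem_su2 hX
    ext i j
    have hij := congrFun (congrFun h i) j
    fin_cases i <;> fin_cases j <;> simp [ofR4, toR4, Complex.ext_iff] at hij ⊢
    · rw [← hij.1, ← hij.2]; simp
    · rw [← hij.1, ← hij.2]; simp
  rw [hlin]
  refine ofR4_mem ⟨_, ?_⟩
  have hre : (X 0 0).re = 0 := by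
    have h00 := congrFun (congrFun hX.1 0) 0
    simp [Complex.ext_iff] at h00
    linarith
  have hs : sqNorm X = (X 0 0).im ^ 2 + (X 1 0).re ^ 2 + (X 1 0).im ^ 2 := by
    simp [sqNorm, EuclideanSpace.norm_sq_eq, toR4, Fin.sum_univ_four, hre]
  have hn := normFactor_mul X t
  rw [hs] at hn
  rw [mem_sphere_zero_iff_norm, EuclideanSpace.norm_eq, Real.sqrt_eq_one]
  simp [Fin.sum_univ_four, hre]
  linarith

/-- A smooth curve in `SU(2)` through `1` with velocity `X`. -/
def curve {X : Mat2} (hX : X ∈ su2) (t : ℝ) : SU2 :=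
  ⟨normFactor X t • (1 + t • X), normFactor_smul_mem hX t⟩

theorem curve_zero {X : Mat2} (hX : X ∈ su2) : curve hX 0 = 1 := by
  apply Subtype.ext
  simp [curve, normFactor_zero]

theorem contMDiff_curve {X : Mat2} (hX : X ∈ su2) : ContMDiff 𝓘(ℝ, ℝ) (𝓡 3) ∞ (curve hX) := by
  refine contMDiff_of_entries fun a b => ContDiff.contMDiff ?_
  have h : ContDiff ℝ ∞ fun t : ℝ => normFactor X t • ((1 : Mat2) a b + t • X a b) :=
    (contDiff_normFactor X).smul (contDiff_const.add (contDiff_id.smul contDiff_const))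
  exact h

theorem hasDerivAt_curve_entry {X : Mat2} (hX : X ∈ su2) (a b : Fin 2) :
    HasDerivAt (fun t => (curve hX t).1 a b) (X a b) 0 := by
  have h := (hasDerivAt_normFactor X).smul
    (((hasDerivAt_id (0 : ℝ)).smul_const (X a b)).const_add ((1 : Mat2) a b))
  exact h.congr_deriv (by simp [normFactor_zero])

theorem hasDerivAt_conj_curve_entry {X : Mat2} (hX : X ∈ su2) (M : Mat2) (a b : Fin 2) :
    HasDerivAt (fun t => ((curve hX t)⁻¹.1 * M * (curve hX t).1) a b) ((M * X - X * M) a b) 0 := by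
  have he (t : ℝ) : ((curve hX t)⁻¹.1 * M * (curve hX t).1) a b =
      (normFactor X t * normFactor X t) •
        (M a b + (t • (M * X - X * M) a b - (t * t) • (X * M * X) a b)) := by
    -- The inverse in `SU(2)` is the conjugate transpose, and `X` is anti-hermitian; the conjugated
    -- matrix is thus a scalar times a polynomial in `t`.
    have hinv : (curve hX t)⁻¹.1 = normFactor X t • (1 - t • X) := by
      have h1 : (curve hX t)⁻¹.1 = (curve hX t).1ᴴ := rfl
      rw [h1]
      simp [curve, Matrix.conjTranspose_smul, hX.1, sub_eq_add_neg]
    rw [hinv]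
    have h2 : (normFactor X t • (1 - t • X)) * M * (normFactor X t • (1 + t • X)) =
        (normFactor X t * normFactor X t) •
          (M + (t • (M * X - X * M) - (t * t) • (X * M * X))) := by
      simp only [Matrix.smul_mul, Matrix.mul_smul, smul_smul, sub_mul, mul_add, one_mul, mul_one,
        Matrix.mul_assoc, smul_sub, smul_add]
      module
    exact congrFun (congrFun h2 a) b
  have hN := (hasDerivAt_normFactor X).mul (hasDerivAt_normFactor X)
  have h := hN.smul ((((hasDerivAt_id (0 : ℝ)).smul_const ((M * X - X * M) a b)).sub
    (((hasDerivAt_id (0 : ℝ)).mul (hasDerivAt_id (0 : ℝ))).smul_const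
      ((X * M * X) a b))).const_add (M a b))
  rw [funext he]
  exact h.congr_deriv (by simp [normFactor_zero])

theorem tangentMatrix_curve {X : Mat2} (hX : X ∈ su2) :
    tangentMatrix (mfderiv 𝓘(ℝ, ℝ) (𝓡 3) (curve hX) 0 (1 : ℝ) : EuclideanSpace ℝ (Fin 3)) = X := by
  ext a b
  have h := mfderiv_comp_apply (I := 𝓘(ℝ, ℝ)) (I' := 𝓡 3) (I'' := 𝓘(ℝ, ℂ)) (0 : ℝ)
    (g := fun g : SU2 => g.1 a b) (f := curve hX)
    ((contMDiff_entry a b).mdifferentiableAt (by simp))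
    ((contMDiff_curve hX).mdifferentiableAt (by simp)) (1 : ℝ)
  have h2 : mfderiv 𝓘(ℝ, ℝ) 𝓘(ℝ, ℂ) ((fun g : SU2 => g.1 a b) ∘ curve hX) 0 (1 : ℝ) = X a b := by
    rw [mfderiv_eq_fderiv]
    have h3 := (hasDerivAt_curve_entry hX a b).hasFDerivAt.fderiv
    exact (congrArg (fun L : ℝ →L[ℝ] ℂ => L 1) h3).trans (by simp)
  rw [h2] at h
  have h3 := mfderiv_congr_point (I := 𝓡 3) (I' := 𝓘(ℝ, ℂ)) (f := fun g : SU2 => g.1 a b)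
    (curve_zero hX)
  refine Eq.trans ?_ h.symm
  exact (congrArg (fun L : EuclideanSpace ℝ (Fin 3) →L[ℝ] ℂ =>
    L (mfderiv 𝓘(ℝ, ℝ) (𝓡 3) (curve hX) 0 (1 : ℝ))) h3).symm

/-! ### Vertical vectors -/

section Vertical

variable {P M : Type*} [TopologicalSpace P] [ChartedSpace R6 P]
  [TopologicalSpace M] [ChartedSpace (EuclideanSpace ℝ (Fin 3)) M]

theorem contMDiff_act (B : PrincipalBundle P M) :
    ContMDiff ((𝓡 6).prod (𝓡 3)) (𝓡 6) ∞ fun x : P × SU2 => B.act x.1 x.2 := by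
  rintro ⟨p, g⟩
  obtain ⟨U, e, _, hpU, hsrc, htgt, he, he', hact⟩ := B.exists_trivialization (B.proj p)
  have hp : p ∈ e.source := by rw [hsrc]; exact hpU
  have hopen : IsOpen (e.source ×ˢ (Set.univ : Set SU2)) := e.open_source.prod isOpen_univ
  have h1 : ContMDiffOn ((𝓡 6).prod (𝓡 3)) ((𝓡 3).prod (𝓡 3)) ∞ (fun x : P × SU2 => e x.1)
      (e.source ×ˢ Set.univ) := he.comp contMDiffOn_fst fun x hx => hx.1
  have h2 : ContMDiffOn ((𝓡 6).prod (𝓡 3)) (𝓡 3) ∞ (fun x : P × SU2 => (e x.1).2 * x.2)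
      (e.source ×ˢ Set.univ) :=
    contMDiff_mul.comp_contMDiffOn ((contMDiff_snd.comp_contMDiffOn h1).prodMk contMDiffOn_snd)
  have h3 := he'.comp ((contMDiff_fst.comp_contMDiffOn h1).prodMk h2) (fun x hx => by
    have hx' := e.map_source hx.1
    rw [htgt] at hx' ⊢
    exact ⟨hx'.1, trivial⟩)
  have hmem : (p, g) ∈ e.source ×ˢ (Set.univ : Set SU2) := ⟨hp, trivial⟩
  refine (h3.congr fun x hx => ?_).contMDiffAt (hopen.mem_nhds hmem)
  have hx' : B.act x.1 x.2 ∈ e.source := by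
    rw [hsrc, Set.mem_preimage, B.proj_act, ← Set.mem_preimage, ← hsrc]
    exact hx.1
  have h4 := (hact x.1 hx.1).2 x.2
  calc B.act x.1 x.2 = e.symm (e (B.act x.1 x.2)) := (e.left_inv hx').symm
    _ = _ := by rw [h4]; rfl

theorem contMDiff_act_left (B : PrincipalBundle P M) (g : SU2) :
    ContMDiff (𝓡 6) (𝓡 6) ∞ fun p => B.act p g :=
  (contMDiff_act B).comp (contMDiff_id.prodMk contMDiff_const)

theorem contMDiff_act_right (B : PrincipalBundle P M) (p : P) :
    ContMDiff (𝓡 3) (𝓡 6) ∞ fun g : SU2 => B.act p g :=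
  (contMDiff_act B).comp (contMDiff_const.prodMk contMDiff_id)

/-- The velocity at `1` of the chosen curve in direction `X`. -/
def curveVelocity {X : Mat2} (hX : X ∈ su2) : EuclideanSpace ℝ (Fin 3) :=
  mfderiv 𝓘(ℝ, ℝ) (𝓡 3) (curve hX) 0 (1 : ℝ)

/-- The fundamental vector field of `X`. -/
def fundamental (B : PrincipalBundle P M) {X : Mat2} (hX : X ∈ su2) (p : P) :
    TangentSpace (𝓡 6) p :=
  mfderiv (𝓡 3) (𝓡 6) (fun g : SU2 => B.act p g) 1 (curveVelocity hX)

/-- The projection is constant on orbits. Where it is not differentiable, `mfderiv` is zero by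
convention, so no regularity of `proj` has to be known. -/
theorem mfderiv_proj_fundamental (B : PrincipalBundle P M) {X : Mat2} (hX : X ∈ su2) (p : P) :
    mfderiv (𝓡 6) (𝓡 3) B.proj p (fundamental B hX p) = 0 := by
  by_cases hd : MDifferentiableAt (𝓡 6) (𝓡 3) B.proj p
  · have hd' : MDifferentiableAt (𝓡 6) (𝓡 3) B.proj (B.act p 1) := by rwa [B.act_one]
    have h := mfderiv_comp_apply (I := 𝓡 3) (I' := 𝓡 6) (I'' := 𝓡 3) (1 : SU2) (g := B.proj)
      (f := fun g : SU2 => B.act p g) hd'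
      ((contMDiff_act_right B p).mdifferentiableAt (by simp)) (curveVelocity hX)
    have hc : B.proj ∘ (fun g : SU2 => B.act p g) = fun _ => B.proj p := by
      funext g
      exact B.proj_act p g
    rw [hc, mfderiv_const] at h
    have h2 := mfderiv_congr_point (I := 𝓡 6) (I' := 𝓡 3) (f := B.proj) (B.act_one p)
    exact (congrArg (fun L : R6 →L[ℝ] EuclideanSpace ℝ (Fin 3) => L (fundamental B hX p))
      h2).symm.trans h.symm
  · rw [mfderiv_zero_of_not_mdifferentiableAt hd]
    rfl

/-- The map `(y, t) ↦ φ⁻¹(y) γ(t)`, where `φ` is the chart at `p` and `γ` the curve of `X`. -/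
def actionMap (B : PrincipalBundle P M) {X : Mat2} (hX : X ∈ su2) (p : P) (x : R6 × ℝ) : P :=
  B.act ((extChartAt (𝓡 6) p).symm x.1) (curve hX x.2)

theorem extD_congr (α : Form1 P) {p q : P} (h : p = q) {u v u' v' : R6} (hu : u = u')
    (hv : v = v') : extD α p u v = extD α q u' v' := by
  subst h hu hv
  rfl

variable [IsManifold (𝓡 6) ∞ P]

theorem contMDiffOn_actionMap (B : PrincipalBundle P M) {X : Mat2} (hX : X ∈ su2) (p : P) :
    ContMDiffOn 𝓘(ℝ, R6 × ℝ) (𝓡 6) ∞ (actionMap B hX p)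
      ((extChartAt (𝓡 6) p).target ×ˢ Set.univ) := by
  have h1 : ContMDiffOn 𝓘(ℝ, R6 × ℝ) (𝓡 6) ∞
      (fun x : R6 × ℝ => (extChartAt (𝓡 6) p).symm x.1)
      ((extChartAt (𝓡 6) p).target ×ˢ Set.univ) :=
    (contMDiffOn_extChartAt_symm p).comp contDiff_fst.contMDiff.contMDiffOn fun x hx => hx.1
  have h2 : ContMDiffOn 𝓘(ℝ, R6 × ℝ) (𝓡 3) ∞ (fun x : R6 × ℝ => curve hX x.2)
      ((extChartAt (𝓡 6) p).target ×ˢ Set.univ) :=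
    ((contMDiff_curve hX).comp contDiff_snd.contMDiff).contMDiffOn
  exact (contMDiff_act B).comp_contMDiffOn (h1.prodMk h2)

theorem mdifferentiableAt_actionMap (B : PrincipalBundle P M) {X : Mat2} (hX : X ∈ su2) (p : P)
    {y : R6} (hy : y ∈ (extChartAt (𝓡 6) p).target) (t : ℝ) :
    MDifferentiableAt 𝓘(ℝ, R6 × ℝ) (𝓡 6) (actionMap B hX p) (y, t) :=
  ((contMDiffOn_actionMap B hX p).contMDiffAt
    (((isOpen_extChartAt_target p).prod isOpen_univ).mem_nhds ⟨hy, trivial⟩)).mdifferentiableAt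
    (by simp)

theorem mfderiv_actionMap_vertical (B : PrincipalBundle P M) {X : Mat2} (hX : X ∈ su2) (p : P)
    {y : R6} (hy : y ∈ (extChartAt (𝓡 6) p).target) :
    (mfderiv 𝓘(ℝ, R6 × ℝ) (𝓡 6) (actionMap B hX p) (y, 0) ((0, 1) : R6 × ℝ) : R6) =
      fundamental B hX ((extChartAt (𝓡 6) p).symm y) := by
  set q := (extChartAt (𝓡 6) p).symm y with hq
  have h1 := mfderiv_comp_apply (I := 𝓘(ℝ, ℝ)) (I' := 𝓘(ℝ, R6 × ℝ)) (I'' := 𝓡 6) (0 : ℝ)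
    (g := actionMap B hX p) (f := fun t : ℝ => (y, t)) (mdifferentiableAt_actionMap B hX p hy 0)
    (by fun_prop : DifferentiableAt ℝ (fun t : ℝ => (y, t)) 0).mdifferentiableAt (1 : ℝ)
  rw [mfderiv_eq_fderiv] at h1
  have h2 : fderiv ℝ (fun t : ℝ => (y, t)) 0 1 = (0, 1) := by
    have h : HasFDerivAt (fun t : ℝ => (y, t)) (ContinuousLinearMap.inr ℝ R6 ℝ) 0 :=
      hasFDerivAt_prodMk_right y 0
    rw [h.fderiv]
    simp
  have h3 := mfderiv_comp_apply (I := 𝓘(ℝ, ℝ)) (I' := 𝓡 3) (I'' := 𝓡 6) (0 : ℝ)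
    (g := fun g : SU2 => B.act q g) (f := curve hX)
    ((contMDiff_act_right B q).mdifferentiableAt (by simp))
    ((contMDiff_curve hX).mdifferentiableAt (by simp)) (1 : ℝ)
  have h4 := mfderiv_congr_point (I := 𝓡 3) (I' := 𝓡 6) (f := fun g : SU2 => B.act q g)
    (curve_zero hX)
  have h5 := congrArg (fun L : EuclideanSpace ℝ (Fin 3) →L[ℝ] R6 => L (curveVelocity hX)) h4
  have h6 := congrArg (fun w : R6 × ℝ =>
    (mfderiv 𝓘(ℝ, R6 × ℝ) (𝓡 6) (actionMap B hX p) (y, 0) : R6 × ℝ →L[ℝ] R6) w) h2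
  exact (h6.symm.trans h1.symm).trans (h3.trans h5)

theorem mfderiv_extChartAt_symm_chartVector (p : P) (v : TangentSpace (𝓡 6) p) :
    (mfderiv 𝓘(ℝ, R6) (𝓡 6) (extChartAt (𝓡 6) p).symm (extChartAt (𝓡 6) p p)
      (chartVector p v) : R6) = v := by
  have hs := (contMDiffOn_extChartAt_symm (I := 𝓡 6) (n := ∞) p).contMDiffAt
    ((isOpen_extChartAt_target p).mem_nhds (mem_extChartAt_target p))
  have h1 := mfderiv_comp_apply (I := 𝓡 6) (I' := 𝓘(ℝ, R6)) (I'' := 𝓡 6) p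
    (g := (extChartAt (𝓡 6) p).symm) (f := extChartAt (𝓡 6) p)
    (hs.mdifferentiableAt (by simp))
    (contMDiffAt_extChartAt (n := ∞).mdifferentiableAt (by simp)) v
  have h2 : (extChartAt (𝓡 6) p).symm ∘ extChartAt (𝓡 6) p =ᶠ[nhds p] id := by
    filter_upwards [extChartAt_source_mem_nhds (I := 𝓡 6) p] with q hq
    exact (extChartAt (𝓡 6) p).left_inv hq
  rw [h2.mfderiv_eq, mfderiv_id] at h1
  exact h1.symm

theorem pullback_actionMap_base (B : PrincipalBundle P M) {X : Mat2} (hX : X ∈ su2) (p : P)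
    {α : Form1 P} (hα : Equivariant B α) (v : TangentSpace (𝓡 6) p) (t : ℝ) :
    pullback α (actionMap B hX p) (extChartAt (𝓡 6) p p, t) (chartVector p v, 0) =
      (curve hX t)⁻¹.1 * α p v * (curve hX t).1 := by
  set y := extChartAt (𝓡 6) p p with hy
  have hyt : y ∈ (extChartAt (𝓡 6) p).target := mem_extChartAt_target p
  have h1 := mfderiv_comp_apply (I := 𝓘(ℝ, R6)) (I' := 𝓘(ℝ, R6 × ℝ)) (I'' := 𝓡 6) y
    (g := actionMap B hX p) (f := fun y : R6 => (y, t)) (mdifferentiableAt_actionMap B hX p hyt t)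
    (by fun_prop : DifferentiableAt ℝ (fun y : R6 => (y, t)) y).mdifferentiableAt
    (chartVector p v)
  rw [mfderiv_eq_fderiv] at h1
  have h2 : fderiv ℝ (fun y : R6 => (y, t)) y (chartVector p v) = (chartVector p v, 0) := by
    have h : HasFDerivAt (fun y : R6 => (y, t)) (ContinuousLinearMap.inl ℝ R6 ℝ) y :=
      hasFDerivAt_prodMk_left y t
    rw [h.fderiv]
    simp
  have hs := (contMDiffOn_extChartAt_symm (I := 𝓡 6) (n := ∞) p).contMDiffAt
    ((isOpen_extChartAt_target p).mem_nhds hyt)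
  have h3 := mfderiv_comp_apply (I := 𝓘(ℝ, R6)) (I' := 𝓡 6) (I'' := 𝓡 6) y
    (g := fun q => B.act q (curve hX t)) (f := (extChartAt (𝓡 6) p).symm)
    ((contMDiff_act_left B _).mdifferentiableAt (by simp))
    (hs.mdifferentiableAt (by simp)) (chartVector p v)
  have h6 := congrArg (fun w : R6 × ℝ =>
    (mfderiv 𝓘(ℝ, R6 × ℝ) (𝓡 6) (actionMap B hX p) (y, t) : R6 × ℝ →L[ℝ] R6) w) h2
  have h7 := (h6.symm.trans h1.symm).trans h3
  have h8 := form_congr α (rfl : actionMap B hX p (y, t) = actionMap B hX p (y, t)) h7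
  refine h8.trans ((hα (curve hX t) _ _).trans ?_)
  have h9 : α ((extChartAt (𝓡 6) p).symm y)
      (mfderiv 𝓘(ℝ, R6) (𝓡 6) (extChartAt (𝓡 6) p).symm y (chartVector p v)) = α p v :=
    form_congr α (extChartAt_to_inv p) (mfderiv_extChartAt_symm_chartVector p v)
  rw [h9]

/-- An equivariant form which is constant on the fundamental field of `X` satisfies
`dα (v, X) = [X, α v]`. -/
theorem extD_fundamental (B : PrincipalBundle P M) {X : Mat2} (hX : X ∈ su2) {α : Form1 P}
    (hs : IsSmooth α) (hα : Equivariant B α) {c : Mat2}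
    (hc : ∀ q, α q (fundamental B hX q) = c) (p : P) (v : TangentSpace (𝓡 6) p) :
    extD α p v (fundamental B hX p) = X * α p v - α p v * X := by
  set y := extChartAt (𝓡 6) p p with hy
  have hyt : y ∈ (extChartAt (𝓡 6) p).target := mem_extChartAt_target p
  have hopen : IsOpen ((extChartAt (𝓡 6) p).target ×ˢ (Set.univ : Set ℝ)) :=
    (isOpen_extChartAt_target p).prod isOpen_univ
  have hmem : (y, (0 : ℝ)) ∈ (extChartAt (𝓡 6) p).target ×ˢ (Set.univ : Set ℝ) := ⟨hyt, trivial⟩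
  have hpt : actionMap B hX p (y, 0) = p := by
    simp only [actionMap]
    rw [curve_zero, B.act_one, hy, extChartAt_to_inv]
  have hbase : (mfderiv 𝓘(ℝ, R6 × ℝ) (𝓡 6) (actionMap B hX p) (y, 0)
      ((chartVector p v, 0) : R6 × ℝ) : R6) = v := by
    have h1 := mfderiv_comp_apply (I := 𝓘(ℝ, R6)) (I' := 𝓘(ℝ, R6 × ℝ)) (I'' := 𝓡 6) y
      (g := actionMap B hX p) (f := fun y : R6 => (y, (0 : ℝ)))
      (mdifferentiableAt_actionMap B hX p hyt 0)
      (by fun_prop : DifferentiableAt ℝ (fun y : R6 => (y, (0 : ℝ))) y).mdifferentiableAt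
      (chartVector p v)
    rw [mfderiv_eq_fderiv] at h1
    have h2 : fderiv ℝ (fun y : R6 => (y, (0 : ℝ))) y (chartVector p v) =
        (chartVector p v, 0) := by
      have h : HasFDerivAt (fun y : R6 => (y, (0 : ℝ))) (ContinuousLinearMap.inl ℝ R6 ℝ) y :=
      hasFDerivAt_prodMk_left y (0 : ℝ)
      rw [h.fderiv]
      simp
    have h3 : actionMap B hX p ∘ (fun y : R6 => (y, (0 : ℝ))) = (extChartAt (𝓡 6) p).symm := by
      funext z
      simp only [actionMap, Function.comp_apply]
      rw [curve_zero, B.act_one]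
    rw [h3] at h1
    have h6 := congrArg (fun w : R6 × ℝ =>
      (mfderiv 𝓘(ℝ, R6 × ℝ) (𝓡 6) (actionMap B hX p) (y, 0) : R6 × ℝ →L[ℝ] R6) w) h2
    exact (h6.symm.trans h1.symm).trans (mfderiv_extChartAt_symm_chartVector p v)
  have hvert : (mfderiv 𝓘(ℝ, R6 × ℝ) (𝓡 6) (actionMap B hX p) (y, 0) ((0, 1) : R6 × ℝ) : R6) =
      fundamental B hX p := by
    rw [mfderiv_actionMap_vertical B hX p hyt, hy, extChartAt_to_inv]
  ext i j
  -- Pulled back by `actionMap`, the two vectors become constant fields on `R6 × ℝ`, so `dα` is a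
  -- difference of two directional derivatives without a bracket term.
  have hmain := extD_mfderiv hs hopen (contMDiffOn_actionMap B hX p) hmem
    ((chartVector p v, 0) : R6 × ℝ) ((0, 1) : R6 × ℝ) i j
  have hcongr := congrFun (congrFun (extD_congr α hpt hbase hvert) i) j
  rw [hcongr] at hmain
  rw [hmain]
  have hdiff (w : R6 × ℝ) : DifferentiableAt ℝ
      (fun x => pullback α (actionMap B hX p) x w i j) (y, 0) :=
    ((contDiffOn_pullback hs hopen (contMDiffOn_actionMap B hX p) w i j).contDiffAt
      (hopen.mem_nhds hmem)).differentiableAt (by simp)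
  -- On the slice `t = 0` the second vector is the fundamental one, where `α` has the constant value
  -- `c`.
  have e1 : fderiv ℝ (fun x => pullback α (actionMap B hX p) x ((0, 1) : R6 × ℝ) i j) (y, 0)
      ((chartVector p v, 0) : R6 × ℝ) = 0 := by
    have h : HasFDerivAt (fun z : R6 => (z, (0 : ℝ))) (ContinuousLinearMap.inl ℝ R6 ℝ) y :=
      hasFDerivAt_prodMk_left y (0 : ℝ)
    have h1 := ((hdiff ((0, 1) : R6 × ℝ)).hasFDerivAt.comp y h).fderiv
    have h2 : (fun x => pullback α (actionMap B hX p) x ((0, 1) : R6 × ℝ) i j) ∘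
        (fun z : R6 => (z, (0 : ℝ))) =ᶠ[nhds y] fun _ => c i j := by
      filter_upwards [(isOpen_extChartAt_target p).mem_nhds hyt] with z hz
      have hpz : actionMap B hX p (z, 0) = (extChartAt (𝓡 6) p).symm z := by
        simp only [actionMap]
        rw [curve_zero, B.act_one]
      have h3 := form_congr α hpz (mfderiv_actionMap_vertical B hX p hz)
      exact congrFun (congrFun (h3.trans (hc _)) i) j
    rw [h2.fderiv_eq] at h1
    have h4 := congrArg (fun L : R6 →L[ℝ] ℂ => L (chartVector p v)) h1
    simpa using h4.symm
  -- Along the orbit, equivariance turns `α v` into its conjugate by `curve hX t`, whose derivative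
  -- at `0` is a commutator.
  have e2 : fderiv ℝ (fun x => pullback α (actionMap B hX p) x
      ((chartVector p v, 0) : R6 × ℝ) i j) (y, 0) ((0, 1) : R6 × ℝ) =
      (α p v * X - X * α p v) i j := by
    have h : HasFDerivAt (fun t : ℝ => (y, t)) (ContinuousLinearMap.inr ℝ R6 ℝ) 0 :=
      hasFDerivAt_prodMk_right y 0
    have h1 := ((hdiff ((chartVector p v, 0) : R6 × ℝ)).hasFDerivAt.comp (0 : ℝ) h).fderiv
    have h2 : (fun x => pullback α (actionMap B hX p) x ((chartVector p v, 0) : R6 × ℝ) i j) ∘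
        (fun t : ℝ => (y, t)) =
        fun t => ((curve hX t)⁻¹.1 * α p v * (curve hX t).1) i j := by
      funext t
      exact congrFun (congrFun (pullback_actionMap_base B hX p hα v t) i) j
    rw [h2, (hasDerivAt_conj_curve_entry hX (α p v) i j).hasFDerivAt.fderiv] at h1
    have h4 := congrArg (fun L : ℝ →L[ℝ] ℂ => L 1) h1
    simpa using h4.symm
  rw [e1, e2]
  simp

end Vertical

/-! ### The complex connection -/

/-! ### Bilinearity of the curvature, and forms of type (0,1) in complex coordinates -/

section ExteriorDerivative

variable {P : Type*} [TopologicalSpace P] [ChartedSpace R6 P]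

theorem extD_antisymm (α : Form1 P) (p : P) (u v : TangentSpace (𝓡 6) p) :
    extD α p u v = -extD α p v u := by
  ext i j
  simp [extD]

theorem wedge_self_antisymm (α : Form1 P) (p : P) (u v : TangentSpace (𝓡 6) p) :
    wedge α α p u v = -wedge α α p v u := by
  simp [wedge]

theorem curvature_antisymm (α : Form1 P) (p : P) (u v : TangentSpace (𝓡 6) p) :
    curvature α p u v = -curvature α p v u := by
  have h : ∀ u v, curvature α p u v = extD α p u v + wedge α α p u v := fun _ _ => rfl
  rw [h, h, extD_antisymm, wedge_self_antisymm, neg_add]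

theorem coordDeriv_eq_fderiv_pullback (α : Form1 P) (p : P) (u w : R6) (i j : Fin 2) :
    coordDeriv α p u w i j = fderiv ℝ (fun y => pullback α (extChartAt (𝓡 6) p).symm y w i j)
      (extChartAt (𝓡 6) p p) u := rfl

theorem chartVector_add (p : P) (u v : TangentSpace (𝓡 6) p) :
    chartVector p (u + v) = chartVector p u + chartVector p v :=
  (mfderiv (𝓡 6) 𝓘(ℝ, R6) (extChartAt (𝓡 6) p) p).map_add u v

variable [IsManifold (𝓡 6) ∞ P]

theorem differentiableAt_pullbackCLM {α : Form1 P} (hα : IsSmooth α) (p : P) (i j : Fin 2) :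
    DifferentiableAt ℝ (pullbackCLM α (extChartAt (𝓡 6) p).symm i j) (extChartAt (𝓡 6) p p) :=
  ((contDiffOn_pullbackCLM hα (isOpen_extChartAt_target p) (contMDiffOn_extChartAt_symm p)
    i j).contDiffAt ((isOpen_extChartAt_target p).mem_nhds
      (mem_extChartAt_target p))).differentiableAt (by simp)

theorem coordDeriv_eq {α : Form1 P} (hα : IsSmooth α) (p : P) (r s : R6) (i j : Fin 2) :
    coordDeriv α p r s i j = fderiv ℝ (pullbackCLM α (extChartAt (𝓡 6) p).symm i j)
      (extChartAt (𝓡 6) p p) r s := by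
  have h := ((differentiableAt_pullbackCLM hα p i j).hasFDerivAt.clm_apply
    (hasFDerivAt_const s _)).fderiv
  have h2 : coordDeriv α p r s i j = fderiv ℝ
    (fun y => pullbackCLM α (extChartAt (𝓡 6) p).symm i j y s) (extChartAt (𝓡 6) p p) r := rfl
  rw [h2, h]
  simp

/-- Smoothness matters: `coordDeriv` is an `fderiv` of `α w`, which is additive in `w` because `α`
is differentiable. -/
theorem curvature_add {α : Form1 P} (hα : IsSmooth α) (p : P)
    (u v w : TangentSpace (𝓡 6) p) :
    curvature α p (u + v) w = curvature α p u w + curvature α p v w := by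
  have h : ∀ u v, curvature α p u v = extD α p u v + wedge α α p u v := fun _ _ => rfl
  have h1 : extD α p (u + v) w = extD α p u w + extD α p v w := by
    ext i j
    simp only [extD, Matrix.of_apply, Matrix.add_apply, coordDeriv_eq hα, chartVector_add,
      map_add, _root_.add_apply]
    ring
  rw [h, h, h, h1]
  simp only [wedge, map_add, add_mul, mul_add]
  abel

/-- In complex coordinates, the exterior derivative of an antilinear form has no component of
type `(2, 0)`. -/
theorem extD_of_antilinear {α : Form1 P} (hα : IsSmooth α)
    {J : ∀ p : P, TangentSpace (𝓡 6) p →ₗ[ℝ] TangentSpace (𝓡 6) p} (hJ : IsIntegrable J)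
    (hαJ : ∀ p v, α p (J p v) = -Complex.I • α p v) (p : P) (u v : TangentSpace (𝓡 6) p) :
    extD α p u v - extD α p (J p u) (J p v) -
      Complex.I • (extD α p (J p u) v + extD α p u (J p v)) = 0 := by
  obtain ⟨z, hp, hz, hz', hzJ⟩ := hJ p
  have hzd {q : P} (hq : q ∈ z.source) : MDifferentiableAt (𝓡 6) 𝓘(ℝ, Fin 3 → ℂ) z q :=
    (hz.contMDiffAt (z.open_source.mem_nhds hq)).mdifferentiableAt (by simp)
  have hzd' {x : Fin 3 → ℂ} (hx : x ∈ z.target) :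
      MDifferentiableAt 𝓘(ℝ, Fin 3 → ℂ) (𝓡 6) z.symm x :=
    (hz'.contMDiffAt (z.open_target.mem_nhds hx)).mdifferentiableAt (by simp)
  have hinv {x : Fin 3 → ℂ} (hx : x ∈ z.target) (w : Fin 3 → ℂ) :
      differential z (z.symm x) (mfderiv 𝓘(ℝ, Fin 3 → ℂ) (𝓡 6) z.symm x w) = w := by
    have h := mfderiv_comp_apply (I := 𝓘(ℝ, Fin 3 → ℂ)) (I' := 𝓡 6) (I'' := 𝓘(ℝ, Fin 3 → ℂ)) x
      (g := z) (f := z.symm) (hzd (z.map_target hx)) (hzd' hx) w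
    have h2 : z ∘ z.symm =ᶠ[nhds x] id := by
      filter_upwards [z.open_target.mem_nhds hx] with y hy
      exact z.right_inv hy
    rw [h2.mfderiv_eq, mfderiv_id] at h
    exact h.symm
  have hinv' {q : P} (hq : q ∈ z.source) (w : TangentSpace (𝓡 6) q) :
      (mfderiv 𝓘(ℝ, Fin 3 → ℂ) (𝓡 6) z.symm (z q) (differential z q w) : R6) = w := by
    have hq' : MDifferentiableAt 𝓘(ℝ, Fin 3 → ℂ) (𝓡 6) z.symm (z q) := hzd' (z.map_source hq)
    have h := mfderiv_comp_apply (I := 𝓡 6) (I' := 𝓘(ℝ, Fin 3 → ℂ)) (I'' := 𝓡 6) q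
      (g := z.symm) (f := z) hq' (hzd hq) w
    have h2 : z.symm ∘ z =ᶠ[nhds q] id := by
      filter_upwards [z.open_source.mem_nhds hq] with y hy
      exact z.left_inv hy
    rw [h2.mfderiv_eq, mfderiv_id] at h
    exact h.symm
  have hanti {x : Fin 3 → ℂ} (hx : x ∈ z.target) (w : Fin 3 → ℂ) :
      pullback α z.symm x (Complex.I • w) = -Complex.I • pullback α z.symm x w := by
    have hxs := z.map_target hx
    have h1 := hzJ (z.symm x) hxs (mfderiv 𝓘(ℝ, Fin 3 → ℂ) (𝓡 6) z.symm x w)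
    rw [hinv hx] at h1
    have h2 := hinv' hxs (J (z.symm x) (mfderiv 𝓘(ℝ, Fin 3 → ℂ) (𝓡 6) z.symm x w))
    rw [h1] at h2
    have h3 : (mfderiv 𝓘(ℝ, Fin 3 → ℂ) (𝓡 6) z.symm x (Complex.I • w) : R6) =
        J (z.symm x) (mfderiv 𝓘(ℝ, Fin 3 → ℂ) (𝓡 6) z.symm x w) := by
      rw [← h2, z.right_inv hx]
    exact (form_congr α rfl h3).trans (hαJ _ _)
  set x := z p with hxdef
  have hx : x ∈ z.target := z.map_source hp
  have hpx : z.symm x = p := z.left_inv hp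
  ext i j
  set D : (Fin 3 → ℂ) → (Fin 3 → ℂ) → ℂ := fun w s =>
    fderiv ℝ (fun y => pullback α z.symm y w i j) x s with hD
  -- In the coordinates `z` the form is antilinear at every point, and its derivatives inherit this
  -- in the slot `w`. In the final expression the derivatives along `i u` and `i v` cancel in pairs,
  -- and the others cancel by `i² = -1`.
  have hDI (w s : Fin 3 → ℂ) : D (Complex.I • w) s = -Complex.I * D w s := by
    have h1 : (fun y => pullback α z.symm y (Complex.I • w) i j) =ᶠ[nhds x]
        fun y => -Complex.I • pullback α z.symm y w i j := by
      filter_upwards [z.open_target.mem_nhds hx] with y hy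
      rw [hanti hy]
      rfl
    have h2 : DifferentiableAt ℝ (fun y => pullback α z.symm y w i j) x :=
      ((contDiffOn_pullback hα z.open_target hz' w i j).contDiffAt
        (z.open_target.mem_nhds hx)).differentiableAt (by simp)
    simp only [hD]
    rw [h1.fderiv_eq]
    exact congrArg (fun L : (Fin 3 → ℂ) →L[ℝ] ℂ => L s)
      (h2.hasFDerivAt.const_smul (-Complex.I)).fderiv
  have hext (r s : TangentSpace (𝓡 6) p) : extD α p r s i j =
      D (differential z p s) (differential z p r) -
        D (differential z p r) (differential z p s) := by
    have h := extD_mfderiv hα z.open_target hz' hx (differential z p r) (differential z p s) i j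
    have h2 := congrFun (congrFun (extD_congr α hpx (hinv' hp r) (hinv' hp s)) i) j
    exact h2.symm.trans h
  have hJp (r : TangentSpace (𝓡 6) p) :
      differential z p (J p r) = Complex.I • differential z p r := hzJ p hp r
  simp only [Matrix.sub_apply, Matrix.smul_apply, Matrix.add_apply, hext, hJp, hDI,
    Matrix.zero_apply, smul_eq_mul]
  linear_combination (D (differential z p v) (differential z p u) -
    D (differential z p u) (differential z p v)) * Complex.I_sq

end ExteriorDerivative

/-! ### Horizontality of `F(A)`, and flatness from integrability -/

section ComplexConnection

variable {P M : Type*} [TopologicalSpace P] [ChartedSpace R6 P] [IsManifold (𝓡 6) ∞ P]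
  [TopologicalSpace M] [ChartedSpace (EuclideanSpace ℝ (Fin 3)) M]
  {B : PrincipalBundle P M} {W : Connection B}

theorem complexConnection_apply (E : Frame B W) (p : P) (v : TangentSpace (𝓡 6) p) :
    complexConnection E p v = W.form p v + Complex.I • E.form p v := rfl

theorem isSmooth_complexConnection (E : Frame B W) : IsSmooth (complexConnection E) := by
  intro a b
  have hI : ContDiff ℝ ∞ fun z : ℂ => Complex.I * z := contDiff_const.mul contDiff_id
  exact (W.smooth a b).add (hI.contMDiff.comp (E.smooth a b))

theorem equivariant_complexConnection (E : Frame B W) :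
    Equivariant B (complexConnection E) := by
  intro g p v
  rw [complexConnection_apply, complexConnection_apply, W.equivariant, E.equivariant]
  simp [mul_add, add_mul]

theorem connection_fundamental (W : Connection B) {X : Mat2} (hX : X ∈ su2) (p : P) :
    W.form p (fundamental B hX p) = X :=
  (W.vertical p (curveVelocity hX)).trans (tangentMatrix_curve hX)

theorem frame_fundamental (E : Frame B W) {X : Mat2} (hX : X ∈ su2) (p : P) :
    E.form p (fundamental B hX p) = 0 :=
  E.horizontal p _ (mfderiv_proj_fundamental B hX p)

theorem complexConnection_fundamental (E : Frame B W) {X : Mat2} (hX : X ∈ su2) (p : P) :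
    complexConnection E p (fundamental B hX p) = X := by
  rw [complexConnection_apply, connection_fundamental, frame_fundamental, smul_zero, add_zero]

/-- The kernel of `E` is exactly the vertical space: `u` minus the fundamental vector of `W u` is
killed by both `W` and `E`. -/
theorem eq_fundamental_of_frame_eq_zero (E : Frame B W) {p : P} {u : TangentSpace (𝓡 6) p}
    (hu : E.form p u = 0) : u = fundamental B (W.mem_su2 p u) p := by
  rw [← sub_eq_zero]
  refine E.nondegenerate p _ ?_ ?_
  · rw [map_sub, connection_fundamental, sub_self]
  · rw [map_sub, frame_fundamental, hu, sub_self]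

/-- The curvature of the complex connection is horizontal. -/
theorem curvature_eq_zero_of_vertical_right (E : Frame B W) {p : P}
    {u : TangentSpace (𝓡 6) p} (hu : E.form p u = 0) (v : TangentSpace (𝓡 6) p) :
    curvature (complexConnection E) p v u = 0 := by
  have h : curvature (complexConnection E) p v u = extD (complexConnection E) p v u +
    wedge (complexConnection E) (complexConnection E) p v u := rfl
  rw [h, eq_fundamental_of_frame_eq_zero E hu,
    extD_fundamental B (W.mem_su2 p u) (isSmooth_complexConnection E)
      (equivariant_complexConnection E) (fun q => complexConnection_fundamental E _ q)]
  simp only [wedge, complexConnection_fundamental]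
  abel

theorem curvature_eq_zero_of_vertical_left (E : Frame B W) {p : P}
    {u : TangentSpace (𝓡 6) p} (hu : E.form p u = 0) (v : TangentSpace (𝓡 6) p) :
    curvature (complexConnection E) p u v = 0 := by
  rw [curvature_antisymm, curvature_eq_zero_of_vertical_right E hu, neg_zero]

theorem connection_almostComplex (E : Frame B W) (p : P) (v : TangentSpace (𝓡 6) p) :
    W.form p (almostComplex E p v) = E.form p v := by
  rw [← sum_comp_tau (W.mem_su2 p _), ← sum_comp_tau (E.mem_su2 p v)]
  have h (i : Fin 3) : comp i (W.form p (almostComplex E p v)) = comp i (E.form p v) :=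
    congrFun (congrArg Prod.fst (coframe_almostComplex E p v)) i
  simp only [h]

theorem frame_almostComplex (E : Frame B W) (p : P) (v : TangentSpace (𝓡 6) p) :
    E.form p (almostComplex E p v) = -W.form p v := by
  rw [← sum_comp_tau (E.mem_su2 p _), ← sum_comp_tau (W.mem_su2 p v)]
  have h (i : Fin 3) : comp i (E.form p (almostComplex E p v)) = -comp i (W.form p v) :=
    congrFun (congrArg Prod.snd (coframe_almostComplex E p v)) i
  simp only [h, neg_smul, Finset.sum_neg_distrib]

/-- As `W ∘ J = E` and `E ∘ J = -W`, one gets `A ∘ J = E - iW = -iA`. Both directions of the first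
equivalence depend on this. -/
theorem complexConnection_almostComplex (E : Frame B W) (p : P) (v : TangentSpace (𝓡 6) p) :
    complexConnection E p (almostComplex E p v) = -Complex.I • complexConnection E p v := by
  rw [complexConnection_apply, complexConnection_apply, connection_almostComplex,
    frame_almostComplex, smul_add, smul_smul, smul_neg, neg_smul, neg_mul, Complex.I_mul_I,
    neg_neg, one_smul]
  abel

theorem curvature_eq_zero_of_isIntegrable (E : Frame B W)
    (hJ : IsIntegrable (almostComplex E)) : curvature (complexConnection E) = 0 := by
  have hs := isSmooth_complexConnection E
  have hF (p : P) (u v : TangentSpace (𝓡 6) p) : curvature (complexConnection E) p u v =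
    extD (complexConnection E) p u v +
      wedge (complexConnection E) (complexConnection E) p u v := rfl
  -- For horizontal `u, v` the vectors `J u, J v` are vertical, so three of the four terms of the
  -- (2,0) part of `dA` can be replaced by those of `-A ∧ A`. Antilinearity of `A` evaluates these,
  -- and they leave `F(A)(u, v) = 0`.
  have hhor (p : P) (u v : TangentSpace (𝓡 6) p) (hu : W.form p u = 0) (hv : W.form p v = 0) :
      curvature (complexConnection E) p u v = 0 := by
    have hu' : E.form p (almostComplex E p u) = 0 := by rw [frame_almostComplex, hu, neg_zero]
    have hv' : E.form p (almostComplex E p v) = 0 := by rw [frame_almostComplex, hv, neg_zero]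
    have h := extD_of_antilinear hs hJ (complexConnection_almostComplex E) p u v
    have h1 := curvature_eq_zero_of_vertical_left E hu' (almostComplex E p v)
    have h2 := curvature_eq_zero_of_vertical_left E hu' v
    have h3 := curvature_eq_zero_of_vertical_right E hv' u
    rw [hF, ← eq_neg_iff_add_eq_zero] at h1 h2 h3
    rw [h1, h2, h3] at h
    rw [hF, ← h]
    simp only [wedge, complexConnection_almostComplex]
    ext i j
    simp only [Matrix.add_apply, Matrix.sub_apply, Matrix.neg_apply, Matrix.smul_apply,
      Matrix.smul_mul, Matrix.mul_smul, smul_eq_mul]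
    ring_nf
    simp only [Complex.I_sq]
    ring
  funext p u v
  have hsplit (u : TangentSpace (𝓡 6) p) : ∃ a b, u = a + b ∧ E.form p a = 0 ∧
      W.form p b = 0 := by
    refine ⟨fundamental B (W.mem_su2 p u) p, u - fundamental B (W.mem_su2 p u) p, by abel,
      frame_fundamental E _ p, ?_⟩
    rw [map_sub, connection_fundamental, sub_self]
  obtain ⟨a, b, rfl, ha, hb⟩ := hsplit u
  obtain ⟨c, d, rfl, hc, hd⟩ := hsplit v
  change curvature (complexConnection E) p (a + b) (c + d) = 0
  rw [curvature_add hs, curvature_eq_zero_of_vertical_left E ha, zero_add, curvature_antisymm,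
    curvature_add hs, curvature_eq_zero_of_vertical_left E hc, zero_add, hhor p d b hd hb,
    neg_zero]

end ComplexConnection

/-! ### Complex coordinates from a flat connection -/

section Smoothness

variable {V E : Type*} [NormedAddCommGroup V] [NormedSpace ℝ V]
  [NormedAddCommGroup E] [NormedSpace ℝ E]

set_option maxSynthPendingDepth 3

/-- Parallel sections are smooth. -/
theorem contDiffOn_of_parallel {B : V → V →L[ℝ] E →L[ℝ] E} {U : Set V} (hU : IsOpen U)
    (hB : ContDiffOn ℝ ∞ B U) {f : V → E}
    (hf : ∀ x ∈ U, HasFDerivAt f ((B x).flip (f x)) x) : ContDiffOn ℝ ∞ f U := by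
  rw [contDiffOn_infty]
  -- Bootstrapping: the equation expresses the derivative of `f` through `B` and `f`, so each order
  -- of regularity yields the next.
  intro n
  induction n with
  | zero =>
    exact contDiffOn_zero.2 fun x hx => (hf x hx).continuousAt.continuousWithinAt
  | succ n ih =>
    push_cast
    rw [contDiffOn_succ_iff_fderiv_of_isOpen hU]
    refine ⟨fun x hx => (hf x hx).differentiableAt.differentiableWithinAt, by simp, ?_⟩
    have hflip : ContDiffOn ℝ n (fun x => (B x).flip) U :=
      (ContinuousLinearMap.flipₗᵢ ℝ V E E).contDiff.comp_contDiffOn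
        (hB.of_le (by exact_mod_cast le_top))
    exact (hflip.clm_apply ih).congr fun x hx => (hf x hx).fderiv

end Smoothness

/-- The matrix `c` at position `(i, j)`, acting on row vectors from the right. -/
def rowAction (i j : Fin 2) : ℂ →L[ℝ] (Fin 2 → ℂ) →L[ℝ] (Fin 2 → ℂ) :=
  LinearMap.toContinuousLinearMap
    { toFun := fun c => (ContinuousLinearMap.single ℝ (fun _ : Fin 2 => ℂ) j).comp
        ((ContinuousLinearMap.mul ℝ ℂ c).comp (ContinuousLinearMap.proj i))
      map_add' := fun c d => by ext f k; simp
      map_smul' := fun r c => by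
        ext f k
        by_cases h : k = j
        · subst h; simp [mul_assoc]
        · simp [h] }

theorem rowAction_apply (i j : Fin 2) (c : ℂ) (f : Fin 2 → ℂ) (k : Fin 2) :
    rowAction i j c f k = if k = j then f i * c else 0 := by
  by_cases h : k = j
  · subst h; simp [rowAction, mul_comm]
  · simp [rowAction, h]

/-- `X` is anti-hermitian and `I • Y` hermitian, so taking the conjugate transpose separates them.
This gives the injectivity of `A` and later splits its curvature. -/
theorem eq_zero_of_add_I_smul_eq_zero {X Y : Mat2} (hX : X ∈ su2) (hY : Y ∈ su2)
    (h : X + Complex.I • Y = 0) : X = 0 ∧ Y = 0 := by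
  have h1 : -X + Complex.I • Y = 0 := by
    have h2 := congrArg Matrix.conjTranspose h
    rw [Matrix.conjTranspose_add, Matrix.conjTranspose_smul, hX.1, hY.1] at h2
    simpa using h2
  have hX0 : X = 0 := by
    have h2 : (2 : ℂ) • X = (X + Complex.I • Y) - (-X + Complex.I • Y) := by module
    rw [h, h1, sub_zero] at h2
    exact (smul_eq_zero.1 h2).resolve_left two_ne_zero
  refine ⟨hX0, ?_⟩
  rw [hX0, zero_add] at h
  exact (smul_eq_zero.1 h).resolve_left Complex.I_ne_zero

section Charts

variable {P : Type*} [TopologicalSpace P] [ChartedSpace R6 P] [IsManifold (𝓡 6) ∞ P]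

theorem mdifferentiableAt_extChartAt_symm' (p : P) {y : R6}
    (hy : y ∈ (extChartAt (𝓡 6) p).target) :
    MDifferentiableAt 𝓘(ℝ, R6) (𝓡 6) (extChartAt (𝓡 6) p).symm y :=
  ((contMDiffOn_extChartAt_symm (n := ∞) p).contMDiffAt
    ((isOpen_extChartAt_target p).mem_nhds hy)).mdifferentiableAt (by simp)

theorem mdifferentiableAt_extChartAt_of_mem (p : P) {q : P}
    (hq : q ∈ (extChartAt (𝓡 6) p).source) :
    MDifferentiableAt (𝓡 6) 𝓘(ℝ, R6) (extChartAt (𝓡 6) p) q :=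
  (contMDiffAt_extChartAt' (n := ∞) (by rwa [extChartAt_source] at hq)).mdifferentiableAt
    (by simp)

theorem pullback_extChartAt_symm (α : Form1 P) (p : P) {q : P}
    (hq : q ∈ (extChartAt (𝓡 6) p).source) (v : TangentSpace (𝓡 6) q) :
    pullback α (extChartAt (𝓡 6) p).symm (extChartAt (𝓡 6) p q)
      (mfderiv (𝓡 6) 𝓘(ℝ, R6) (extChartAt (𝓡 6) p) q v) = α q v := by
  have h1 := mfderiv_comp_apply (I := 𝓡 6) (I' := 𝓘(ℝ, R6)) (I'' := 𝓡 6) q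
    (g := (extChartAt (𝓡 6) p).symm) (f := extChartAt (𝓡 6) p)
    (mdifferentiableAt_extChartAt_symm' p ((extChartAt (𝓡 6) p).map_source hq))
    (mdifferentiableAt_extChartAt_of_mem p hq) v
  have h2 : (extChartAt (𝓡 6) p).symm ∘ extChartAt (𝓡 6) p =ᶠ[nhds q] id := by
    filter_upwards [(isOpen_extChartAt_source (I := 𝓡 6) p).mem_nhds hq] with r hr
    exact (extChartAt (𝓡 6) p).left_inv hr
  rw [h2.mfderiv_eq, mfderiv_id] at h1
  exact form_congr α ((extChartAt (𝓡 6) p).left_inv hq) h1.symm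

theorem mfderiv_extChartAt_symm_injective (p : P) {y : R6}
    (hy : y ∈ (extChartAt (𝓡 6) p).target) {w : R6}
    (hw : mfderiv 𝓘(ℝ, R6) (𝓡 6) (extChartAt (𝓡 6) p).symm y w = 0) : w = 0 := by
  have h1 := mfderiv_comp_apply (I := 𝓘(ℝ, R6)) (I' := 𝓡 6) (I'' := 𝓘(ℝ, R6)) y
    (g := extChartAt (𝓡 6) p) (f := (extChartAt (𝓡 6) p).symm)
    (mdifferentiableAt_extChartAt_of_mem p ((extChartAt (𝓡 6) p).map_target hy))
    (mdifferentiableAt_extChartAt_symm' p hy) w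
  have h2 : extChartAt (𝓡 6) p ∘ (extChartAt (𝓡 6) p).symm =ᶠ[nhds y] id := by
    filter_upwards [(isOpen_extChartAt_target (I := 𝓡 6) p).mem_nhds hy] with r hr
    exact (extChartAt (𝓡 6) p).right_inv hr
  rw [h2.mfderiv_eq, mfderiv_id, hw, map_zero] at h1
  exact h1

end Charts

/-! ### Holomorphic coordinates from the parallel rows of a flat connection -/

section FlatCoordinates

variable {P M : Type*} [TopologicalSpace P] [ChartedSpace R6 P]
  [TopologicalSpace M] [ChartedSpace (EuclideanSpace ℝ (Fin 3)) M]

set_option maxSynthPendingDepth 3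

/-- A matrix-valued form in the chart at `p`, acting on row vectors from the right. -/
def rowConnection (α : Form1 P) (p : P) (y : R6) : R6 →L[ℝ] (Fin 2 → ℂ) →L[ℝ] (Fin 2 → ℂ) :=
  ∑ i, ∑ j, (rowAction i j).comp (pullbackCLM α (extChartAt (𝓡 6) p).symm i j y)

theorem rowConnection_apply (α : Form1 P) (p : P) (y w : R6) (f : Fin 2 → ℂ) (k : Fin 2) :
    rowConnection α p y w f k =
      f 0 * pullback α (extChartAt (𝓡 6) p).symm y w 0 k +
        f 1 * pullback α (extChartAt (𝓡 6) p).symm y w 1 k := by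
  fin_cases k <;>
  simp [rowConnection, Fin.sum_univ_two, rowAction_apply, pullbackCLM_apply]

variable [IsManifold (𝓡 6) ∞ P]

theorem contDiffOn_rowConnection {α : Form1 P} (hα : IsSmooth α) (p : P) :
    ContDiffOn ℝ ∞ (rowConnection α p) (extChartAt (𝓡 6) p).target := by
  unfold rowConnection
  refine ContDiffOn.sum fun i _ => ContDiffOn.sum fun j _ => ?_
  exact contDiffOn_const.clm_comp (contDiffOn_pullbackCLM hα (isOpen_extChartAt_target p)
    (contMDiffOn_extChartAt_symm p) i j)

/-- The left-hand side is the row vector `f` times the curvature of `α` in the chart. Matrices act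
from the right, so `u` followed by `v` multiplies by `α(u) α(v)`; this fixes the order of the
quadratic terms. -/
theorem rowConnection_flat {α : Form1 P} (hα : IsSmooth α) (hF : curvature α = 0) (p : P)
    {y : R6} (hy : y ∈ (extChartAt (𝓡 6) p).target) (u v : R6) (f : Fin 2 → ℂ) :
    fderiv ℝ (rowConnection α p) y u v f - fderiv ℝ (rowConnection α p) y v u f +
      rowConnection α p y v (rowConnection α p y u f) -
        rowConnection α p y u (rowConnection α p y v f) = 0 := by
  have hopen := isOpen_extChartAt_target (I := 𝓡 6) p
  have hsymm := contMDiffOn_extChartAt_symm (I := 𝓡 6) (n := ∞) p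
  have hBd : DifferentiableAt ℝ (rowConnection α p) y :=
    ((contDiffOn_rowConnection hα p).contDiffAt (hopen.mem_nhds hy)).differentiableAt (by simp)
  have hd (w : R6) (i k : Fin 2) : DifferentiableAt ℝ
      (fun x => pullback α (extChartAt (𝓡 6) p).symm x w i k) y :=
    ((contDiffOn_pullback hα hopen hsymm w i k).contDiffAt
      (hopen.mem_nhds hy)).differentiableAt (by simp)
  ext k
  have hder (s w : R6) : fderiv ℝ (rowConnection α p) y s w f k =
      f 0 * fderiv ℝ (fun x => pullback α (extChartAt (𝓡 6) p).symm x w 0 k) y s +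
        f 1 * fderiv ℝ (fun x => pullback α (extChartAt (𝓡 6) p).symm x w 1 k) y s := by
    have h1 : HasFDerivAt (fun x => rowConnection α p x w f k) _ y :=
      (hasFDerivAt_pi'.1 ((hBd.hasFDerivAt.clm_apply (hasFDerivAt_const w y)).clm_apply
        (hasFDerivAt_const f y))) k
    have h2 : HasFDerivAt (fun x => rowConnection α p x w f k) _ y :=
      (((hd w 0 k).hasFDerivAt.const_mul (f 0)).add
        ((hd w 1 k).hasFDerivAt.const_mul (f 1))).congr_of_eventuallyEq
        (Filter.Eventually.of_forall fun x => rowConnection_apply α p x w f k)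
    have h3 := congrArg (fun L : R6 →L[ℝ] ℂ => L s) (h1.unique h2)
    simpa using h3
  have hcurv (i : Fin 2) := congrFun (congrFun (congrFun (congrFun (congrFun hF
    ((extChartAt (𝓡 6) p).symm y))
    (mfderiv 𝓘(ℝ, R6) (𝓡 6) (extChartAt (𝓡 6) p).symm y u))
    (mfderiv 𝓘(ℝ, R6) (𝓡 6) (extChartAt (𝓡 6) p).symm y v)) i) k
  have hcurv' (i : Fin 2) :
      fderiv ℝ (fun x => pullback α (extChartAt (𝓡 6) p).symm x v i k) y u -
        fderiv ℝ (fun x => pullback α (extChartAt (𝓡 6) p).symm x u i k) y v +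
      (pullback α (extChartAt (𝓡 6) p).symm y u * pullback α (extChartAt (𝓡 6) p).symm y v -
        pullback α (extChartAt (𝓡 6) p).symm y v * pullback α (extChartAt (𝓡 6) p).symm y u) i k
      = 0 := by
    rw [← extD_mfderiv hα hopen hsymm hy u v i k]
    exact hcurv i
  have h0 := hcurv' 0
  have h1 := hcurv' 1
  simp only [Matrix.sub_apply, Matrix.mul_apply, Fin.sum_univ_two] at h0 h1
  simp only [Pi.sub_apply, Pi.add_apply, Pi.zero_apply, hder, rowConnection_apply]
  linear_combination f 0 * h0 + f 1 * h1

variable {B : PrincipalBundle P M} {W : Connection B}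

theorem complexConnection_injective (E : Frame B W) (p : P) {v : TangentSpace (𝓡 6) p}
    (h00 : complexConnection E p v 0 0 = 0) (h01 : complexConnection E p v 0 1 = 0)
    (h10 : complexConnection E p v 1 0 = 0) : v = 0 := by
  have htr : (complexConnection E p v).trace = 0 := by
    rw [complexConnection_apply, Matrix.trace_add, Matrix.trace_smul, (W.mem_su2 p v).2,
      (E.mem_su2 p v).2, smul_zero, add_zero]
  have h : complexConnection E p v = 0 := by
    rw [Matrix.trace_fin_two, h00, zero_add] at htr
    ext i j
    fin_cases i <;> fin_cases j
    · exact h00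
    · exact h01
    · exact h10
    · exact htr
  obtain ⟨h1, h2⟩ := eq_zero_of_add_I_smul_eq_zero (W.mem_su2 p v) (E.mem_su2 p v) h
  exact E.nondegenerate p v h1 h2

/-- The complex conjugates of three entries of a matrix with rows `g₀` and `g₁`. -/
def conjEntries : ((Fin 2 → ℂ) × (Fin 2 → ℂ)) →L[ℝ] (Fin 3 → ℂ) :=
  ContinuousLinearMap.pi ![
    (Complex.conjCLE : ℂ →L[ℝ] ℂ).comp ((ContinuousLinearMap.proj 0).comp
      (ContinuousLinearMap.fst ℝ (Fin 2 → ℂ) (Fin 2 → ℂ))),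
    (Complex.conjCLE : ℂ →L[ℝ] ℂ).comp ((ContinuousLinearMap.proj 1).comp
      (ContinuousLinearMap.fst ℝ (Fin 2 → ℂ) (Fin 2 → ℂ))),
    (Complex.conjCLE : ℂ →L[ℝ] ℂ).comp ((ContinuousLinearMap.proj 0).comp
      (ContinuousLinearMap.snd ℝ (Fin 2 → ℂ) (Fin 2 → ℂ)))]

theorem conjEntries_apply (g : (Fin 2 → ℂ) × (Fin 2 → ℂ)) :
    conjEntries g = ![star (g.1 0), star (g.1 1), star (g.2 0)] := by
  ext i
  fin_cases i <;> rfl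

theorem isIntegrable_of_curvature_eq_zero (E : Frame B W)
    (hF : curvature (complexConnection E) = 0) : IsIntegrable (almostComplex E) := by
  intro p
  set A := complexConnection E with hA
  have hs : IsSmooth A := isSmooth_complexConnection E
  set φ := extChartAt (𝓡 6) p with hφ
  have hopen : IsOpen φ.target := isOpen_extChartAt_target p
  set y₀ := φ p with hy₀
  have hy₀t : y₀ ∈ φ.target := mem_extChartAt_target p
  have hC := contDiffOn_rowConnection hs p
  have hpar (e : Fin 2 → ℂ) := exists_parallel (B := rowConnection A p) (x₀ := y₀)
    ((hC.contDiffAt (hopen.mem_nhds hy₀t)).of_le (WithTop.coe_le_coe.2 le_top))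
    (by
      filter_upwards [hopen.mem_nhds hy₀t] with y hy u v f
      exact rowConnection_flat hs hF p hy u v f) e
  -- `g₀` and `g₁` are the rows of a local solution of `dg = g A` with `g = 1` at `y₀`.
  obtain ⟨g₀, hg₀, hd₀⟩ := hpar ![1, 0]
  obtain ⟨g₁, hg₁, hd₁⟩ := hpar ![0, 1]
  set Z : R6 → (Fin 3 → ℂ) := fun y => conjEntries (g₀ y, g₁ y) with hZ
  obtain ⟨U₁, hU₁, hU₁o, hU₁m⟩ := eventually_nhds_iff.1
    (hd₀.and (hd₁.and (hopen.mem_nhds hy₀t)))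
  have hZd {y : R6} (hy : y ∈ U₁) : HasFDerivAt Z (conjEntries.comp
      (((rowConnection A p y).flip (g₀ y)).prod ((rowConnection A p y).flip (g₁ y)))) y :=
    conjEntries.hasFDerivAt.comp y ((hU₁ y hy).1.prodMk (hU₁ y hy).2.1)
  have hZs : ContDiffOn ℝ ∞ Z U₁ := by
    have hC' := hC.mono fun y hy => (hU₁ y hy).2.2
    exact conjEntries.contDiff.comp_contDiffOn
      ((contDiffOn_of_parallel hU₁o hC' fun y hy => (hU₁ y hy).1).prodMk
        (contDiffOn_of_parallel hU₁o hC' fun y hy => (hU₁ y hy).2.1))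
  -- Since `g = 1` at `y₀`, the differential of `Z` there consists of the conjugates of three
  -- entries of `A`, which determine the tangent vector because `A` is trace-free and injective.
  have hinj : Function.Injective (fderiv ℝ Z y₀) := by
    rw [injective_iff_map_eq_zero]
    intro w hw
    rw [(hZd hU₁m).fderiv] at hw
    simp only [ContinuousLinearMap.comp_apply, conjEntries_apply] at hw
    have e0 := congrFun hw 0
    have e1 := congrFun hw 1
    have e2 := congrFun hw 2
    simp only [ContinuousLinearMap.prod_apply, ContinuousLinearMap.flip_apply,
      rowConnection_apply, hg₀, hg₁] at e0 e1 e2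
    simp at e0 e1 e2
    exact mfderiv_extChartAt_symm_injective p hy₀t (complexConnection_injective E _ e0 e1 e2)
  have hfin : Module.finrank ℝ R6 = Module.finrank ℝ (Fin 3 → ℂ) := by
    rw [finrank_euclideanSpace_fin, Module.finrank_pi_fintype]
    simp [Complex.finrank_real_complex]
  set L : R6 ≃L[ℝ] (Fin 3 → ℂ) := (LinearEquiv.ofInjectiveOfFinrankEq
    (fderiv ℝ Z y₀ : R6 →ₗ[ℝ] (Fin 3 → ℂ)) hinj hfin).toContinuousLinearEquiv with hL
  have hL' : (L : R6 →L[ℝ] (Fin 3 → ℂ)) = fderiv ℝ Z y₀ := by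
    ext1 w
    rfl
  have hZ₀ : ContDiffAt ℝ ∞ Z y₀ := hZs.contDiffAt (hU₁o.mem_nhds hU₁m)
  have hZ₀d : HasFDerivAt Z (L : R6 →L[ℝ] (Fin 3 → ℂ)) y₀ := by
    rw [hL']
    exact (hZ₀.differentiableAt (by simp)).hasFDerivAt
  -- Smoothness of the inverse on the whole target needs an invertible derivative at every point of
  -- the source; invertibility is an open condition, so shrinking the domain suffices.
  have hinv : ∀ᶠ y in nhds y₀, ∃ L' : R6 ≃L[ℝ] (Fin 3 → ℂ),
      (L' : R6 →L[ℝ] (Fin 3 → ℂ)) = fderiv ℝ Z y := by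
    have hc : ContinuousAt (fderiv ℝ Z) y₀ :=
      (hZ₀.fderiv_right (m := 0) (by simp)).continuousAt
    exact hc.preimage_mem_nhds (hL' ▸ L.nhds)
  obtain ⟨U₂, hU₂, hU₂o, hU₂m⟩ := eventually_nhds_iff.1 hinv
  set h₀ := hZ₀.toOpenPartialHomeomorph Z hZ₀d (by simp) with hh₀
  set h := h₀.restrOpen (U₁ ∩ U₂) (hU₁o.inter hU₂o) with hh
  have hcoe : (h : R6 → (Fin 3 → ℂ)) = Z := rfl
  have hsub {y : R6} (hy : y ∈ h.source) : y ∈ U₁ ∧ y ∈ U₂ := by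
    rw [hh, OpenPartialHomeomorph.restrOpen_source] at hy
    exact hy.2
  have hy₀h : y₀ ∈ h.source := by
    rw [hh, OpenPartialHomeomorph.restrOpen_source]
    exact ⟨hZ₀.mem_toOpenPartialHomeomorph_source hZ₀d (by simp), hU₁m, hU₂m⟩
  have hsymm : ContDiffOn ℝ ∞ h.symm h.target := by
    intro x hx
    obtain ⟨h1, h2⟩ := hsub (h.map_target hx)
    obtain ⟨L', hL'⟩ := hU₂ _ h2
    have h3 : ContDiffAt ℝ ∞ Z (h.symm x) := hZs.contDiffAt (hU₁o.mem_nhds h1)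
    exact (h.contDiffAt_symm (f₀' := L') hx (by
      rw [hL']
      exact (h3.differentiableAt (by simp)).hasFDerivAt) h3).contDiffWithinAt
  set z := (chartAt R6 p).trans h with hz
  have hzs {q : P} (hq : q ∈ z.source) : q ∈ φ.source ∧ φ q ∈ h.source := by
    rw [hz, OpenPartialHomeomorph.trans_source] at hq
    exact ⟨by rw [hφ, extChartAt_source]; exact hq.1, hq.2⟩
  have hzcoe : (z : P → (Fin 3 → ℂ)) = Z ∘ φ := rfl
  have hzsymm : (z.symm : (Fin 3 → ℂ) → P) = φ.symm ∘ h.symm := rfl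
  have hZc : ContMDiffOn 𝓘(ℝ, R6) 𝓘(ℝ, Fin 3 → ℂ) ∞ Z U₁ := hZs.contMDiffOn
  refine ⟨z, ?_, ?_, ?_, ?_⟩
  · rw [hz, OpenPartialHomeomorph.trans_source]
    exact ⟨mem_chart_source R6 p, hy₀h⟩
  · rw [hzcoe]
    refine hZc.comp (t := U₁) ?_ fun q hq => (hsub (hzs hq).2).1
    refine contMDiffOn_extChartAt.mono fun q hq => ?_
    have h1 := (hzs hq).1
    rwa [hφ, extChartAt_source] at h1
  · rw [hzsymm]
    have htgt {x : Fin 3 → ℂ} (hx : x ∈ z.target) : x ∈ h.target := by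
      rw [hz, OpenPartialHomeomorph.trans_target] at hx
      exact hx.1
    refine (contMDiffOn_extChartAt_symm p).comp (hsymm.contMDiffOn.mono fun x hx => htgt hx)
      fun x hx => ?_
    exact (hU₁ _ (hsub (h.map_target (htgt hx))).1).2.2
  · intro q hq v
    obtain ⟨hqs, hqh⟩ := hzs hq
    have hq1 := (hsub hqh).1
    -- This is `dz = conj (g A)` in three entries. With `A ∘ J = -i A`, the conjugation turns `-i`
    -- into `i`; this is why the coordinates are conjugated entries of `g`.
    have hdz (v : TangentSpace (𝓡 6) q) : differential z q v =
        ![star (g₀ (φ q) 0 * A q v 0 0 + g₀ (φ q) 1 * A q v 1 0),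
          star (g₀ (φ q) 0 * A q v 0 1 + g₀ (φ q) 1 * A q v 1 1),
          star (g₁ (φ q) 0 * A q v 0 0 + g₁ (φ q) 1 * A q v 1 0)] := by
      have e1 := mfderiv_comp_apply (I := 𝓡 6) (I' := 𝓘(ℝ, R6)) (I'' := 𝓘(ℝ, Fin 3 → ℂ)) q
        (g := Z) (f := φ) (hZd hq1).differentiableAt.mdifferentiableAt
        (mdifferentiableAt_extChartAt_of_mem p hqs) v
      rw [mfderiv_eq_fderiv, (hZd hq1).fderiv] at e1
      have e2 (w : R6) : conjEntries (((rowConnection A p (φ q)).flip (g₀ (φ q))).prod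
          ((rowConnection A p (φ q)).flip (g₁ (φ q))) w) =
          ![star (g₀ (φ q) 0 * pullback A φ.symm (φ q) w 0 0 +
              g₀ (φ q) 1 * pullback A φ.symm (φ q) w 1 0),
            star (g₀ (φ q) 0 * pullback A φ.symm (φ q) w 0 1 +
              g₀ (φ q) 1 * pullback A φ.symm (φ q) w 1 1),
            star (g₁ (φ q) 0 * pullback A φ.symm (φ q) w 0 0 +
              g₁ (φ q) 1 * pullback A φ.symm (φ q) w 1 0)] := by
        rw [conjEntries_apply]
        simp only [ContinuousLinearMap.prod_apply, ContinuousLinearMap.flip_apply,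
          rowConnection_apply]
        rfl
      refine e1.trans ((e2 _).trans ?_)
      have e3 := pullback_extChartAt_symm A p hqs v
      rw [← e3]
    rw [hdz, hdz, hA, complexConnection_almostComplex]
    ext i
    fin_cases i <;> simp <;> ring

end FlatCoordinates

/-! ### Splitting the curvature of the complex connection -/

theorem add_mem_su2 {X Y : Mat2} (hX : X ∈ su2) (hY : Y ∈ su2) : X + Y ∈ su2 :=
  ⟨by rw [Matrix.conjTranspose_add, hX.1, hY.1, neg_add],
    by rw [Matrix.trace_add, hX.2, hY.2, add_zero]⟩

theorem sub_mem_su2 {X Y : Mat2} (hX : X ∈ su2) (hY : Y ∈ su2) : X - Y ∈ su2 :=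
  ⟨by rw [Matrix.conjTranspose_sub, hX.1, hY.1]; abel,
    by rw [Matrix.trace_sub, hX.2, hY.2, sub_zero]⟩

theorem lie_mem_su2 {X Y : Mat2} (hX : X ∈ su2) (hY : Y ∈ su2) : X * Y - Y * X ∈ su2 :=
  ⟨by
    rw [Matrix.conjTranspose_sub, Matrix.conjTranspose_mul, Matrix.conjTranspose_mul, hX.1, hY.1,
      neg_mul_neg, neg_mul_neg, neg_sub],
    by rw [Matrix.trace_sub, Matrix.trace_mul_comm, sub_self]⟩

section

variable {P M : Type*} [TopologicalSpace P] [ChartedSpace R6 P] [IsManifold (𝓡 6) ∞ P]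
  [TopologicalSpace M] [ChartedSpace (EuclideanSpace ℝ (Fin 3)) M]

theorem hasFDerivAt_chart_pullback {α : Form1 P} (hα : IsSmooth α) (p : P) (w : R6)
    (i j : Fin 2) : HasFDerivAt (fun y => pullback α (extChartAt (𝓡 6) p).symm y w i j)
      (fderiv ℝ (fun y => pullback α (extChartAt (𝓡 6) p).symm y w i j) (extChartAt (𝓡 6) p p))
      (extChartAt (𝓡 6) p p) :=
  (((contDiffOn_pullback hα (isOpen_extChartAt_target p) (contMDiffOn_extChartAt_symm p) w
    i j).contDiffAt ((isOpen_extChartAt_target p).mem_nhds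
      (mem_extChartAt_target p))).differentiableAt (by simp)).hasFDerivAt

/-- `su(2)` is cut out by real-linear equations on the entries, and differentiation preserves these.
-/
theorem coordDeriv_mem_su2 {α : Form1 P} (hα : IsSmooth α) (hsu : ∀ p v, α p v ∈ su2) (p : P)
    (u w : R6) : (Matrix.of fun a b => coordDeriv α p u w a b) ∈ su2 := by
  have hd := hasFDerivAt_chart_pullback hα p w
  constructor
  · ext i j
    simp only [Matrix.conjTranspose_apply, Matrix.of_apply, Matrix.neg_apply,
      coordDeriv_eq_fderiv_pullback]
    have h1 := (Complex.conjCLE : ℂ →L[ℝ] ℂ).hasFDerivAt.comp _ (hd j i)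
    have h2 : (Complex.conjCLE : ℂ →L[ℝ] ℂ) ∘
        (fun y => pullback α (extChartAt (𝓡 6) p).symm y w j i) =
        fun y => -pullback α (extChartAt (𝓡 6) p).symm y w i j := by
      funext y
      exact congrFun (congrFun (hsu _ _).1 i) j
    rw [h2] at h1
    exact congrArg (fun L : R6 →L[ℝ] ℂ => L u) (h1.unique (hd i j).fun_neg)
  · rw [Matrix.trace_fin_two]
    simp only [Matrix.of_apply, coordDeriv_eq_fderiv_pullback]
    have h1 := (hd 0 0).add (hd 1 1)
    have h2 : ((fun y => pullback α (extChartAt (𝓡 6) p).symm y w 0 0) +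
        fun y => pullback α (extChartAt (𝓡 6) p).symm y w 1 1) = fun _ => 0 := by
      funext y
      have h3 := (hsu ((extChartAt (𝓡 6) p).symm y)
        (mfderiv 𝓘(ℝ, R6) (𝓡 6) (extChartAt (𝓡 6) p).symm y w)).2
      rw [Matrix.trace_fin_two] at h3
      exact h3
    rw [h2] at h1
    exact congrArg (fun L : R6 →L[ℝ] ℂ => L u) (h1.unique (hasFDerivAt_const 0 _))

theorem extD_mem_su2 {α : Form1 P} (hα : IsSmooth α) (hsu : ∀ p v, α p v ∈ su2) (p : P)
    (u v : TangentSpace (𝓡 6) p) : extD α p u v ∈ su2 :=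
  sub_mem_su2 (coordDeriv_mem_su2 hα hsu p (chartVector p u) (chartVector p v))
    (coordDeriv_mem_su2 hα hsu p (chartVector p v) (chartVector p u))

variable {B : PrincipalBundle P M} {W : Connection B}

theorem extD_complexConnection (E : Frame B W) (p : P) (u v : TangentSpace (𝓡 6) p) :
    extD (complexConnection E) p u v = extD W.form p u v + Complex.I • extD E.form p u v := by
  have h (r s : R6) (i j : Fin 2) : coordDeriv (complexConnection E) p r s i j =
      coordDeriv W.form p r s i j + Complex.I * coordDeriv E.form p r s i j := by
    have h1 := (hasFDerivAt_chart_pullback W.smooth p s i j).add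
      ((hasFDerivAt_chart_pullback E.smooth p s i j).const_mul Complex.I)
    exact congrArg (fun L : R6 →L[ℝ] ℂ => L r) h1.fderiv
  ext i j
  simp only [extD, Matrix.of_apply, Matrix.add_apply, Matrix.smul_apply, h, smul_eq_mul]
  ring

/-- Expanding `A ∧ A` bilinearly, the factor `i²` gives `E ∧ E` its minus sign, and the mixed terms
complete `dE` to `∇E`. -/
theorem curvature_complexConnection (E : Frame B W) (p : P) (u v : TangentSpace (𝓡 6) p) :
    curvature (complexConnection E) p u v =
      (curvature W.form p u v - wedge E.form E.form p u v) +
        Complex.I • covD W.form E.form p u v := by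
  have h1 : curvature (complexConnection E) p u v = extD (complexConnection E) p u v +
    wedge (complexConnection E) (complexConnection E) p u v := rfl
  have h2 : curvature W.form p u v = extD W.form p u v + wedge W.form W.form p u v := rfl
  have h3 : covD W.form E.form p u v = extD E.form p u v + wedge W.form E.form p u v +
    wedge E.form W.form p u v := rfl
  rw [h1, h2, h3, extD_complexConnection]
  simp only [wedge, complexConnection_apply]
  ext i j
  simp only [Matrix.add_apply, Matrix.sub_apply, Matrix.smul_apply, smul_eq_mul, add_mul, mul_add,
    Matrix.smul_mul, Matrix.mul_smul]
  linear_combination ((E.form p u * E.form p v) i j - (E.form p v * E.form p u) i j) * Complex.I_sq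

theorem curvature_sub_wedge_mem_su2 (E : Frame B W) (p : P) (u v : TangentSpace (𝓡 6) p) :
    curvature W.form p u v - wedge E.form E.form p u v ∈ su2 :=
  sub_mem_su2 (add_mem_su2 (extD_mem_su2 W.smooth W.mem_su2 p u v)
    (lie_mem_su2 (W.mem_su2 p u) (W.mem_su2 p v))) (lie_mem_su2 (E.mem_su2 p u) (E.mem_su2 p v))

theorem covD_mem_su2 (E : Frame B W) (p : P) (u v : TangentSpace (𝓡 6) p) :
    covD W.form E.form p u v ∈ su2 := by
  have h : covD W.form E.form p u v = extD E.form p u v +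
      (W.form p u * E.form p v - E.form p v * W.form p u) +
      (E.form p u * W.form p v - W.form p v * E.form p u) := by
    have h3 : covD W.form E.form p u v = extD E.form p u v + wedge W.form E.form p u v +
      wedge E.form W.form p u v := rfl
    rw [h3]
    simp only [wedge]
    abel
  rw [h]
  exact add_mem_su2 (add_mem_su2 (extD_mem_su2 E.smooth E.mem_su2 p u v)
    (lie_mem_su2 (W.mem_su2 p u) (E.mem_su2 p v))) (lie_mem_su2 (E.mem_su2 p u) (W.mem_su2 p v))

theorem curvature_complexConnection_eq_zero_iff (E : Frame B W) :
    curvature (complexConnection E) = 0 ↔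
      covD W.form E.form = 0 ∧ curvature W.form = wedge E.form E.form := by
  constructor
  · intro h
    have h1 (p : P) (u v : TangentSpace (𝓡 6) p) :=
      eq_zero_of_add_I_smul_eq_zero (curvature_sub_wedge_mem_su2 E p u v) (covD_mem_su2 E p u v)
        ((curvature_complexConnection E p u v).symm.trans
          (congrFun (congrFun (congrFun h p) u) v))
    exact ⟨funext fun p => funext fun u => funext fun v => (h1 p u v).2,
      funext fun p => funext fun u => funext fun v => sub_eq_zero.1 (h1 p u v).1⟩
  · rintro ⟨h1, h2⟩
    funext p u v
    rw [curvature_complexConnection, h1, h2, sub_self, zero_add]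
    exact smul_zero _

theorem isIntegrable_iff_curvature_eq_zero (E : Frame B W) :
    IsIntegrable (almostComplex E) ↔ curvature (complexConnection E) = 0 :=
  ⟨curvature_eq_zero_of_isIntegrable E, isIntegrable_of_curvature_eq_zero E⟩

end

end SU2Lift

end

theorem proposition5 {P M : Type*}
    [TopologicalSpace P] [ChartedSpace SU2Lift.R6 P] [IsManifold (𝓡 6) ∞ P]
    [TopologicalSpace M] [ChartedSpace (EuclideanSpace ℝ (Fin 3)) M] [IsManifold (𝓡 3) ∞ M]
    (B : SU2Lift.PrincipalBundle P M) (W : SU2Lift.Connection B) (E : SU2Lift.Frame B W) :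
    (SU2Lift.IsIntegrable (SU2Lift.almostComplex E) ↔
      SU2Lift.curvature (SU2Lift.complexConnection E) = 0) ∧
    (SU2Lift.IsIntegrable (SU2Lift.almostComplex E) ↔
      SU2Lift.covD W.form E.form = 0 ∧
        SU2Lift.curvature W.form = SU2Lift.wedge E.form E.form) :=
  ⟨SU2Lift.isIntegrable_iff_curvature_eq_zero E,
    (SU2Lift.isIntegrable_iff_curvature_eq_zero E).trans
      (SU2Lift.curvature_complexConnection_eq_zero_iff E)⟩
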